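/- Let $\mathcal{G}$ be a graphon, i.e. (a representative given by) a measurable symmetric function $\mathcal{G}:[0,1]\times[0,1]\to[0,1]$. Let $T_{\mathcal G}$ be its self-adjoint kernel operator on the complex Hilbert space $L^2([0,1])$, $(T_{\mathcal G}f)(x)=\int_0^1\mathcal{G}(x,y)f(y)\,dy$. Write $\|\mathcal{G}\|_1=\iint|\mathcal{G}|$ and $\|\mathcal{G}\|_2=(\iint\mathcal{G}^2)^{1/2}$, and put $$\textstyle\det^{(2)}(I-z\mathcal{G})=\prod_j(1-\lambda_jz)e^{\lambda_jz},\qquad \psi_{\mathcal{G}}(z)=\det^{(2)}(I-z\mathcal{G})\,\exp\!\left(z^2\cdot\frac{\|\mathcal{G}\|_2^2-\|\mathcal{G}\|_1}{2}\right),$$ where $\lambda_j$ runs over the nonzero eigenvalues of $T_{\mathcal G}$ with multiplicity. Let $(G_n)$ be a sequence of finite simple graphs with $|V(G_n)|\to\infty$ that left-converges to $\mathcal{G}$: for every finite simple graph $F$, with $\hom(F,G_n)$ the number of graph homomorphisms $F\to G_n$, $$\frac{\hom(F,G_n)}{|V(G_n)|^{|V(F)|}}\longrightarrow\int_{[0,1]^{V(F)}}\prod_{ij\in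 E(F)}\mathcal{G}(x_i,x_j)\,dx.$$ Let $A(G_n)$ be the adjacency matrix of $G_n$ and $\psi_n(z)=\det\!\big(I-zA(G_n)/|V(G_n)|\big)$, a polynomial in $z$. Then the product defining $\det^{(2)}(I-z\mathcal{G})$ converges unconditionally for every $z\in\mathbb{C}$, and: 1. $\psi_n(z)\to\psi_{\mathcal{G}}(z)$ for every $z\in\mathbb{C}$; 2. $\psi_n\to\psi_{\mathcal{G}}$ uniformly on every compact subset of $\mathbb{C}$; 3. for every $k\ge0$ the coefficient of $z^k$ in $\psi_n$ converges to the coefficient of $z^k$ in the Taylor series of $\psi_{\mathcal{G}}$ at $0$. Moreover, $\psi_{\mathcal{G}}$ is entire and of Laguerre–Pólya class (it is not identically zero, and it is a locally uniform limit on $\mathbb{C}$ of nonzero real polynomials all of whose complex roots are real). Its zeros are exactly the reciprocals $1/\lambda$ of the nonzero eigenvalues $\lambda$ of $T_{\mathcal G}$, and the order of the zero $1/\lambda$ is the (finite) dimension of the eigenspace of $\lambda$. -/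

import Mathlib

open MeasureTheory Filter Topology Polynomial unitInterval

noncomputable section

/-- The density `t(F, G) = hom(F, G) / |V(G)|^|V(F)|` of (not necessarily injective) homomorphisms
from `F` to the finite graph `G`. -/
def SimpleGraph.homDensity {k : ℕ} (F : SimpleGraph (Fin k)) {V : Type*} [Fintype V]
    (G : SimpleGraph V) : ℝ :=
  (Nat.card (F →g G) : ℝ) / (Fintype.card V : ℝ) ^ k

/-- The normalized reciprocal characteristic polynomial `det(I - z A(G)/|V(G)|)` of a finite
graph `G`, as a polynomial in `z`. -/
def SimpleGraph.psi {V : Type*} [Fintype V] [DecidableEq V] (G : SimpleGraph V)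
    [DecidableRel G.Adj] : ℂ[X] :=
  (((Fintype.card V : ℂ)⁻¹) • G.adjMatrix ℂ).charpolyRev

/-- With `φ(x) = det(xI - A(G))` and `N = |V(G)|`, the polynomial `psi` is
`x^{-N} φ(x)` at `x = N / z`, for `z ≠ 0`. -/
theorem SimpleGraph.psi_eval_eq {V : Type*} [Fintype V] [DecidableEq V] (G : SimpleGraph V)
    [DecidableRel G.Adj] (z : ℂ) (hz : z ≠ 0) :
    G.psi.eval z = ((Fintype.card V : ℂ) / z)⁻¹ ^ Fintype.card V *
      (G.adjMatrix ℂ).charpoly.eval ((Fintype.card V : ℂ) / z) := by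
  rw [Matrix.eval_charpoly, SimpleGraph.psi, Matrix.charpolyRev, ← Matrix.det_smul,
    ← Polynomial.coe_evalRingHom, RingHom.map_det]
  congr 1
  ext i j
  have : Nonempty V := ⟨i⟩
  have hN : (Fintype.card V : ℂ) ≠ 0 := by exact_mod_cast Fintype.card_ne_zero
  by_cases hij : i = j
  · subst hij
    simp
    field_simp
  · simp [Matrix.one_apply_ne, hij]
    split_ifs <;> simp [div_eq_mul_inv, mul_comm]

/-- A graphon, through a representative of its class: a measurable symmetric function
`[0,1] × [0,1] → [0,1]`. -/
structure Graphon where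
  /-- the kernel -/
  toFun : I → I → ℝ
  measurable : Measurable (Function.uncurry toFun)
  symm : ∀ x y, toFun x y = toFun y x
  nonneg : ∀ x y, 0 ≤ toFun x y
  le_one : ∀ x y, toFun x y ≤ 1

namespace Graphon

variable (W : Graphon)

/-- The homomorphism density `t(F, W) = ∫_{[0,1]^k} ∏_{ij ∈ E(F)} W(x_i, x_j) dx`. -/
def homDensity {k : ℕ} (F : SimpleGraph (Fin k)) : ℝ := by
  classical
  exact ∫ x : Fin k → I,
    ∏ p : Fin k × Fin k with p.1 < p.2 ∧ F.Adj p.1 p.2, W.toFun (x p.1) (x p.2)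

/-- `‖W‖₁`, the `L¹` norm of the kernel. -/
def norm1 : ℝ := ∫ p : I × I, |W.toFun p.1 p.2|

/-- `‖W‖₂`, the `L²` norm of the kernel. -/
def norm2 : ℝ := Real.sqrt (∫ p : I × I, W.toFun p.1 p.2 ^ 2)

theorem integrable_coe (f : Lp ℂ 2 (volume : Measure I)) : Integrable (f : I → ℂ) :=
  (Lp.memLp f).integrable (by norm_num)

theorem integrable_mul (f : Lp ℂ 2 (volume : Measure I)) (x : I) :
    Integrable (fun y => (W.toFun x y : ℂ) * f y) := by
  refine (integrable_coe f).bdd_mul (c := 1) ?_ ?_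
  · exact (Complex.measurable_ofReal.comp
      (W.measurable.comp measurable_prodMk_left)).aestronglyMeasurable
  · filter_upwards with y
    rw [Complex.norm_real, Real.norm_of_nonneg (W.nonneg x y)]
    exact W.le_one x y

theorem norm_integral_le (f : Lp ℂ 2 (volume : Measure I)) (x : I) :
    ‖∫ y, (W.toFun x y : ℂ) * f y‖ ≤ ‖f‖ := by
  calc ‖∫ y, (W.toFun x y : ℂ) * f y‖ ≤ ∫ y, ‖(W.toFun x y : ℂ) * f y‖ :=
        norm_integral_le_integral_norm _
    _ ≤ ∫ y, ‖f y‖ := by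
        refine integral_mono (W.integrable_mul f x).norm (integrable_coe f).norm fun y => ?_
        simp only [norm_mul, Complex.norm_real, Real.norm_of_nonneg (W.nonneg x y)]
        exact mul_le_of_le_one_left (norm_nonneg _) (W.le_one x y)
    _ = (eLpNorm f 1 volume).toReal := by
        rw [integral_norm_eq_lintegral_enorm (integrable_coe f).1, eLpNorm_one_eq_lintegral_enorm]
    _ ≤ ‖f‖ := by
        rw [Lp.norm_def]
        exact ENNReal.toReal_mono (Lp.eLpNorm_ne_top f)
          (eLpNorm_le_eLpNorm_of_exponent_le (by norm_num) (Lp.aestronglyMeasurable f))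

theorem memLp_integral (f : Lp ℂ 2 (volume : Measure I)) :
    MemLp (fun x => ∫ y, (W.toFun x y : ℂ) * f y) 2 (volume : Measure I) := by
  refine MemLp.of_bound ?_ ‖f‖ (Eventually.of_forall (W.norm_integral_le f))
  have h : StronglyMeasurable (fun p : I × I => (W.toFun p.1 p.2 : ℂ) * f p.2) :=
    (Complex.measurable_ofReal.comp W.measurable).stronglyMeasurable.mul
      ((Lp.stronglyMeasurable f).comp_measurable measurable_snd)
  exact h.integral_prod_right'.aestronglyMeasurable

/-- The kernel operator `(T_W f)(x) = ∫ W(x, y) f(y) dy` of a graphon, on `L²([0,1]; ℂ)`. -/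
def kernelOp : Lp ℂ 2 (volume : Measure I) →L[ℂ] Lp ℂ 2 (volume : Measure I) :=
  LinearMap.mkContinuous
    { toFun := fun f => (W.memLp_integral f).toLp
      map_add' := by
        intro f g
        rw [← MemLp.toLp_add]
        congr 1
        ext x
        rw [Pi.add_apply, ← integral_add (W.integrable_mul f x) (W.integrable_mul g x)]
        refine integral_congr_ae ?_
        filter_upwards [Lp.coeFn_add f g] with y hy
        rw [hy, Pi.add_apply, mul_add]
      map_smul' := by
        intro c f
        rw [RingHom.id_apply, ← MemLp.toLp_const_smul]
        congr 1
        ext x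
        rw [Pi.smul_apply, ← integral_smul]
        refine integral_congr_ae ?_
        filter_upwards [Lp.coeFn_smul c f] with y hy
        rw [hy, Pi.smul_apply, smul_eq_mul, smul_eq_mul]
        ring }
    1 (by
      intro f
      have h := Lp.norm_le_of_ae_bound (f := (W.memLp_integral f).toLp) (norm_nonneg f) (by
        filter_upwards [(W.memLp_integral f).coeFn_toLp] with x hx
        rw [hx]
        exact W.norm_integral_le f x)
      simpa [measureUnivNNReal] using h)

theorem kernelOp_apply_ae (f : Lp ℂ 2 (volume : Measure I)) :
    W.kernelOp f =ᵐ[volume] fun x => ∫ y, (W.toFun x y : ℂ) * f y :=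
  (W.memLp_integral f).coeFn_toLp

end Graphon

/-- The factor of the regularized determinant `det^{(p)}(I - zT)` contributed by `μ ∈ ℂ`, namely
`[(1 - μ z) exp(∑_{k=1}^{p-1} μ^k z^k / k)]^m`, where `m` is the (algebraic) multiplicity of `μ` as
an eigenvalue of `T`. It is `1` if `μ` is not an eigenvalue, and also if `μ = 0`. -/
def regDetFactor {E : Type*} [AddCommGroup E] [Module ℂ E] (p : ℕ) (T : Module.End ℂ E)
    (z μ : ℂ) : ℂ :=
  ((1 - μ * z) * Complex.exp (∑ k ∈ Finset.Ico 1 p, μ ^ k * z ^ k / k)) ^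
    Module.finrank ℂ (T.maxGenEigenspace μ)

/-- The regularized characteristic determinant `det^{(p)}(I - zT)`, a product over the eigenvalues
of `T` with multiplicity. -/
def regDet {E : Type*} [AddCommGroup E] [Module ℂ E] (p : ℕ) (T : Module.End ℂ E) (z : ℂ) : ℂ :=
  ∏' μ : ℂ, regDetFactor p T z μ

/-- The characteristic power series
`ψ_W(z) = det^{(2)}(I - zW) · exp(z² (‖W‖₂² - ‖W‖₁) / 2)` of a graphon. -/
def Graphon.psi (W : Graphon) (z : ℂ) : ℂ :=
  regDet 2 (W.kernelOp : Module.End ℂ (Lp ℂ 2 (volume : Measure I))) z *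
    Complex.exp (z ^ 2 * (((W.norm2 ^ 2 - W.norm1) / 2 : ℝ) : ℂ))

/-- Left-convergence of a sequence of finite graphs to a graphon: the density of every finite
graph `F` converges. -/
def LeftConverges {V : ℕ → Type*} [∀ n, Fintype (V n)] (G : ∀ n, SimpleGraph (V n))
    (W : Graphon) : Prop :=
  ∀ (k : ℕ) (F : SimpleGraph (Fin k)),
    Tendsto (fun n => F.homDensity (G n)) atTop (𝓝 (W.homDensity F))

/-- The Laguerre–Pólya class: functions on `ℂ`, not identically zero, that are locally uniform
limits on `ℂ` of (nonzero) real polynomials all of whose complex roots are real. -/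
def IsLaguerrePolya (f : ℂ → ℂ) : Prop :=
  f ≠ 0 ∧ ∃ P : ℕ → ℝ[X],
    (∀ n, P n ≠ 0 ∧ ∀ z : ℂ, aeval z (P n) = 0 → z.im = 0) ∧
    TendstoLocallyUniformly (fun n z => aeval z (P n)) f atTop

end

/-!
The eigenvalues of the kernel operator and of the normalized adjacency matrices `A(G_n) / |V(G_n)|`
enter only through their power sums. On the side of the graphs, the power sum of order `k ≥ 2` is
the trace of a `k`-th power, that is, the density of the cycle of length `k` in `G_n` (the edge
density if `k = 2`). On the side of the graphon, expanding the rows `W(x, ·)` in an eigenbasis shows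
that it is the trace `∫ W⁽ᵏ⁾(x, x) dx` of the iterated kernel, that is, the density of the cycle of
length `k ≥ 3`, but `‖W‖₂²` instead of the edge density `‖W‖₁` for `k = 2`
(`Graphon.hasSum_eigenvalue_pow`, `Graphon.homDensity_cycleGraph`).

If all `|aᵢ| ≤ 1` and `∑ |aᵢ|² < ∞`, the product of the genus-one factors
`E₁(aᵢ z) = (1 - aᵢ z) e^{aᵢ z}` is entire and equals `exp (-∑_{k ≥ 2} pₖ zᵏ / k)` on the unit disc,
where `pₖ` is the power sum of order `k` (`tprod_primaryFactor_eq_exp`). The adjacency matrix has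
trace zero, hence `det (I - z A / N)` is such a product; for the graphon, the factor
`exp (z² (‖W‖₂² - ‖W‖₁) / 2)` corrects the term `k = 2`. Thus both functions are the exponential of
the generating function of the densities of cycles, and left-convergence yields pointwise
convergence on the unit disc (`LeftConverges.tendsto_psi_eval`).

The bound `|E₁(w)| ≤ exp (|w|² / 2)` makes the polynomials `ψ_n` bounded on discs, uniformly in `n`,
so that Cauchy's formula and Cauchy's estimates upgrade convergence on a single circle to
convergence of the coefficients and to uniform convergence on compact sets
(`tendsto_iteratedDeriv_of_tendsto_sphere`, `tendstoUniformlyOn_of_tendsto_sphere`). The `ψ_n` are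
real polynomials with real roots, which gives the Laguerre–Pólya class. The zeros of `ψ_W` are read
off from the product (`Graphon.analyticOrderAt_psi`).

The kernel operator is compact because it is Hilbert–Schmidt: the sum of `‖T vᵢ‖²` over an
orthonormal family is at most `1`, by Bessel's inequality for the rows.
-/

open MeasureTheory Filter Topology Polynomial unitInterval

noncomputable section

/-! ### Products of elementary factors of genus one -/

/-- The elementary factor of genus one, `E₁(w) = (1 - w) e^w`. -/
def primaryFactor (w : ℂ) : ℂ := (1 - w) * Complex.exp w

theorem hasDerivAt_primaryFactor (w : ℂ) :
    HasDerivAt primaryFactor (-(w * Complex.exp w)) w := by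
  have h := ((hasDerivAt_id w).const_sub 1).mul (Complex.hasDerivAt_exp w)
  refine h.congr_deriv ?_
  simp
  ring

theorem differentiable_primaryFactor : Differentiable ℂ primaryFactor :=
  fun w => (hasDerivAt_primaryFactor w).differentiableAt

theorem norm_primaryFactor_le (w : ℂ) : ‖primaryFactor w‖ ≤ Real.exp (‖w‖ ^ 2 / 2) := by
  have h1 : ‖1 - w‖ ^ 2 ≤ Real.exp ((‖w‖ ^ 2 - 2 * w.re) / 2) ^ 2 := by
    have h2 : ‖1 - w‖ ^ 2 = 1 + (‖w‖ ^ 2 - 2 * w.re) := by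
      rw [Complex.sq_norm, Complex.sq_norm, Complex.normSq_apply, Complex.normSq_apply]
      simp
      ring
    rw [h2, ← Real.exp_nat_mul, add_comm]
    refine (Real.add_one_le_exp _).trans (le_of_eq ?_)
    congr 1
    push_cast
    ring
  have h3 := abs_le_of_sq_le_sq h1 (Real.exp_nonneg _)
  rw [primaryFactor, norm_mul, Complex.norm_exp]
  calc ‖1 - w‖ * Real.exp w.re
      ≤ Real.exp ((‖w‖ ^ 2 - 2 * w.re) / 2) * Real.exp w.re :=
        mul_le_mul_of_nonneg_right ((le_abs_self _).trans h3) (Real.exp_nonneg _)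
    _ = Real.exp (‖w‖ ^ 2 / 2) := by
        rw [← Real.exp_add]
        congr 1
        ring

theorem norm_primaryFactor_sub_one_le (w : ℂ) :
    ‖primaryFactor w - 1‖ ≤ ‖w‖ ^ 2 * Real.exp ‖w‖ := by
  have h := (convex_closedBall (0 : ℂ) ‖w‖).norm_image_sub_le_of_norm_hasDerivWithin_le
    (f := primaryFactor) (C := ‖w‖ * Real.exp ‖w‖) (x := 0) (y := w)
    (fun x _ => (hasDerivAt_primaryFactor x).hasDerivWithinAt) (fun x hx => ?_) (by simp) (by simp)
  · simp only [primaryFactor, sub_zero, Complex.exp_zero, mul_one] at h ⊢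
    refine h.trans (le_of_eq (by ring))
  · have hx' : ‖x‖ ≤ ‖w‖ := by simpa using hx
    rw [norm_neg, norm_mul, Complex.norm_exp]
    gcongr
    exact (Complex.re_le_norm x).trans hx'

/-- On the unit disc, `E₁(w) = exp (-∑_{k ≥ 2} wᵏ / k)`. -/
theorem hasSum_exp_primaryFactor {w : ℂ} (hw : ‖w‖ < 1) :
    ∃ s : ℂ, HasSum (fun k : ℕ => w ^ (k + 2) / ((k + 2 : ℕ) : ℂ)) s ∧
      primaryFactor w = Complex.exp (-s) := by
  have h := (hasSum_nat_add_iff' 2).2 (Complex.hasSum_taylorSeries_neg_log hw)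
  refine ⟨_, h, ?_⟩
  have h1 : 1 - w ≠ 0 := by
    intro h0
    rw [← sub_eq_zero.1 h0] at hw
    simp at hw
  have h2 : -(-Complex.log (1 - w) - ∑ i ∈ Finset.range 2, w ^ i / (i : ℂ))
      = Complex.log (1 - w) + w := by
    simp [Finset.sum_range_succ]
    ring
  rw [h2, Complex.exp_add, Complex.exp_log h1, primaryFactor]

section Product

variable {ι : Type*} {a : ι → ℂ}

theorem summable_norm_primaryFactor_sub_one (h1 : ∀ i, ‖a i‖ ≤ 1)
    (h2 : Summable fun i => ‖a i‖ ^ 2) (z : ℂ) :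
    Summable fun i => ‖primaryFactor (a i * z) - 1‖ := by
  refine Summable.of_nonneg_of_le (fun _ => norm_nonneg _) (fun i => ?_)
    (h2.mul_right (‖z‖ ^ 2 * Real.exp ‖z‖))
  refine (norm_primaryFactor_sub_one_le _).trans ?_
  rw [norm_mul, mul_pow, mul_assoc]
  gcongr
  exact mul_le_of_le_one_left (norm_nonneg _) (h1 i)

theorem multipliable_primaryFactor (h1 : ∀ i, ‖a i‖ ≤ 1)
    (h2 : Summable fun i => ‖a i‖ ^ 2) (z : ℂ) :
    Multipliable fun i => primaryFactor (a i * z) := by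
  have h := multipliable_one_add_of_summable (summable_norm_primaryFactor_sub_one h1 h2 z)
  simpa using h

theorem tprod_primaryFactor_ne_zero (h1 : ∀ i, ‖a i‖ ≤ 1)
    (h2 : Summable fun i => ‖a i‖ ^ 2) {z : ℂ} (hz : ∀ i, a i * z ≠ 1) :
    ∏' i, primaryFactor (a i * z) ≠ 0 := by
  have h := tprod_one_add_ne_zero_of_summable (f := fun i => primaryFactor (a i * z) - 1)
    (fun i => ?_) (summable_norm_primaryFactor_sub_one h1 h2 z)
  · simpa using h
  · simpa [primaryFactor, sub_eq_zero] using (hz i).symm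

theorem differentiable_tprod_primaryFactor (h1 : ∀ i, ‖a i‖ ≤ 1)
    (h2 : Summable fun i => ‖a i‖ ^ 2) :
    Differentiable ℂ fun z => ∏' i, primaryFactor (a i * z) := by
  intro z₀
  set R : ℝ := ‖z₀‖ + 1 with hR
  have hd : ∀ i, Differentiable ℂ fun z => primaryFactor (a i * z) := fun i =>
    differentiable_primaryFactor.comp (differentiable_id.const_mul _)
  have h := Summable.hasProdLocallyUniformlyOn_one_add (f := fun i z => primaryFactor (a i * z) - 1)
    (K := Metric.ball (0 : ℂ) R) Metric.isOpen_ball (h2.mul_right (R ^ 2 * Real.exp R))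
    (Eventually.of_forall fun i z hz => ?_)
    (fun i => ((hd i).sub_const 1).continuous.continuousOn)
  · have h' := h.differentiableOn ?_ Metric.isOpen_ball
    · have h3 := h'.differentiableAt (Metric.isOpen_ball.mem_nhds (by simp [hR] : z₀ ∈ _))
      simpa using h3
    · refine Eventually.of_forall fun s => ?_
      simp only [add_sub_cancel]
      exact (Differentiable.fun_finsetProd fun i _ => hd i).differentiableOn
  · have hz' : ‖z‖ ≤ R := (mem_ball_zero_iff.1 hz).le
    refine (norm_primaryFactor_sub_one_le _).trans ?_
    rw [norm_mul, mul_pow, mul_assoc]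
    gcongr
    exact (mul_le_of_le_one_left (norm_nonneg _) (h1 i)).trans hz'

theorem summable_mul_pow_div (h1 : ∀ i, ‖a i‖ ≤ 1)
    (h2 : Summable fun i => ‖a i‖ ^ 2) {z : ℂ} (hz : ‖z‖ < 1) :
    Summable fun p : ι × ℕ => (a p.1 * z) ^ (p.2 + 2) / ((p.2 + 2 : ℕ) : ℂ) := by
  refine Summable.of_norm_bounded (g := fun p : ι × ℕ => ‖a p.1‖ ^ 2 * ‖z‖ ^ p.2)
    (Summable.mul_of_nonneg (f := fun i => ‖a i‖ ^ 2) (g := fun k : ℕ => ‖z‖ ^ k) h2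
      (summable_geometric_of_lt_one (norm_nonneg _) hz)
      (fun i => sq_nonneg _) (fun k => pow_nonneg (norm_nonneg _) _)) fun p => ?_
  rw [norm_div, norm_pow, norm_mul, Complex.norm_natCast]
  have h3 : (1 : ℝ) ≤ ((p.2 + 2 : ℕ) : ℝ) := Nat.one_le_cast.2 (by omega)
  refine (div_le_self (by positivity) h3).trans ?_
  rw [mul_pow]
  exact mul_le_mul (pow_le_pow_of_le_one (norm_nonneg _) (h1 _) (by omega))
    (pow_le_pow_of_le_one (norm_nonneg _) hz.le (by omega)) (by positivity) (by positivity)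

/-- The power sums `∑ᵢ aᵢᵏ` with `k ≥ 2` determine `∏ᵢ E₁(aᵢ z)` on the unit disc. -/
theorem tprod_primaryFactor_eq_exp (h1 : ∀ i, ‖a i‖ ≤ 1)
    (h2 : Summable fun i => ‖a i‖ ^ 2) {z : ℂ} (hz : ‖z‖ < 1) :
    ∏' i, primaryFactor (a i * z) =
      Complex.exp (-∑' k : ℕ, (∑' i, a i ^ (k + 2)) * (z ^ (k + 2) / ((k + 2 : ℕ) : ℂ))) := by
  have hw : ∀ i, ‖a i * z‖ < 1 := fun i => by
    rw [norm_mul]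
    exact (mul_le_of_le_one_left (norm_nonneg _) (h1 i)).trans_lt hz
  choose s hs hs' using fun i => hasSum_exp_primaryFactor (hw i)
  have hsum := summable_mul_pow_div h1 h2 hz
  have hs2 : HasSum s (∑' p : ι × ℕ, (a p.1 * z) ^ (p.2 + 2) / ((p.2 + 2 : ℕ) : ℂ)) :=
    hsum.hasSum.prod_fiberwise hs
  have hprod : HasProd (fun i => primaryFactor (a i * z)) _ :=
    hs2.neg.cexp.congr_fun fun i => hs' i
  have hcomm : ∑' p : ι × ℕ, (a p.1 * z) ^ (p.2 + 2) / ((p.2 + 2 : ℕ) : ℂ) =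
      ∑' (k : ℕ) (i : ι), (a i * z) ^ (k + 2) / ((k + 2 : ℕ) : ℂ) :=
    hsum.tsum_prod.trans
      (Summable.tsum_comm
        (f := fun i (k : ℕ) => (a i * z) ^ (k + 2) / ((k + 2 : ℕ) : ℂ)) hsum).symm
  rw [hprod.tprod_eq, hcomm]
  congr 2
  refine tsum_congr fun k => ?_
  rw [← tsum_mul_right]
  refine tsum_congr fun i => ?_
  rw [mul_pow, mul_div_assoc]

/-- Finitely many factors can be split off; what remains is entire, and vanishes only where one of
the remaining factors does. -/
theorem exists_tprod_primaryFactor_eq_mul (h1 : ∀ i, ‖a i‖ ≤ 1)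
    (h2 : Summable fun i => ‖a i‖ ^ 2) (t : Finset ι) :
    ∃ g : ℂ → ℂ, Differentiable ℂ g ∧ (∀ z, (∀ i ∉ t, a i * z ≠ 1) → g z ≠ 0) ∧
      ∀ z, ∏' i, primaryFactor (a i * z) = (∏ i ∈ t, primaryFactor (a i * z)) * g z := by
  classical
  set a' : ι → ℂ := fun i => if i ∈ t then 0 else a i with ha'
  have hle : ∀ i, ‖a' i‖ ≤ ‖a i‖ := fun i => by
    simp only [ha']
    split_ifs <;> simp
  have h1' : ∀ i, ‖a' i‖ ≤ 1 := fun i => (hle i).trans (h1 i)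
  have h2' : Summable fun i => ‖a' i‖ ^ 2 :=
    h2.of_nonneg_of_le (fun _ => sq_nonneg _) fun i => by
      gcongr
      exact hle i
  refine ⟨fun z => ∏' i, primaryFactor (a' i * z), differentiable_tprod_primaryFactor h1' h2',
    fun z hz => tprod_primaryFactor_ne_zero h1' h2' fun i => ?_, fun z => ?_⟩
  · by_cases hi : i ∈ t
    · simp [ha', hi]
    · simpa [ha', hi] using hz i hi
  · have ht : HasProd (fun i => if i ∈ t then primaryFactor (a i * z) else 1)
        (∏ i ∈ t, primaryFactor (a i * z)) := by
      have := hasProd_prod_of_ne_finset_one (L := .unconditional ι) (s := t)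
        (f := fun i => if i ∈ t then primaryFactor (a i * z) else 1) fun i hi => if_neg hi
      rwa [Finset.prod_congr rfl fun i hi => if_pos hi] at this
    refine ((ht.mul (multipliable_primaryFactor h1' h2' z).hasProd).congr_fun fun i => ?_).tprod_eq
    by_cases hi : i ∈ t <;> simp [ha', hi, primaryFactor]

end Product

/-! ### Bounded sequences of entire functions -/

section Convergence

variable {F : ℕ → ℂ → ℂ} {f : ℂ → ℂ}

/-- Derivatives at the origin converge: Cauchy's formula passes to the limit along a
bounded pointwise convergent sequence. -/
theorem tendsto_iteratedDeriv_of_tendsto_sphere {R M : ℝ} (hR : 0 < R)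
    (hF : ∀ n, Differentiable ℂ (F n)) (hf : Differentiable ℂ f)
    (hM : ∀ n z, ‖z‖ ≤ R → ‖F n z‖ ≤ M)
    (hlim : ∀ z, ‖z‖ = R → Tendsto (fun n => F n z) atTop (𝓝 (f z))) (k : ℕ) :
    Tendsto (fun n => iteratedDeriv k (F n) 0) atTop (𝓝 (iteratedDeriv k f 0)) := by
  have hc : ∀ g : ℂ → ℂ, Differentiable ℂ g →
      iteratedDeriv k g 0 = (2 * Real.pi * Complex.I / k.factorial)⁻¹ •
        ∮ z in C(0, R), (1 / (z - 0) ^ (k + 1)) • g z := fun g hg => by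
    have : (2 * Real.pi * Complex.I / k.factorial : ℂ) ≠ 0 := by
      simp [Nat.factorial_ne_zero, Real.pi_ne_zero]
    rw [DiffContOnCl.circleIntegral_one_div_sub_center_pow_smul hR k hg.diffContOnCl,
      inv_smul_smul₀ this]
  rw [hc f hf]
  simp_rw [fun n => hc (F n) (hF n)]
  refine Tendsto.const_smul ?_ _
  have hmem : ∀ θ : ℝ, ‖circleMap 0 R θ‖ = R := fun θ => by simp [abs_of_pos hR]
  have hne : ∀ θ : ℝ, circleMap 0 R θ ≠ 0 := fun θ => by
    rw [← norm_pos_iff, hmem]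
    exact hR
  refine intervalIntegral.tendsto_integral_filter_of_dominated_convergence
    (fun _ => R * (1 / R ^ (k + 1) * M)) (Eventually.of_forall fun n => ?_)
    (Eventually.of_forall fun n => ?_) (by simp) ?_
  · refine Continuous.aestronglyMeasurable ?_
    have h1 : Continuous fun θ : ℝ => F n (circleMap 0 R θ) :=
      (hF n).continuous.comp (continuous_circleMap 0 R)
    simp only [deriv_circleMap, sub_zero]
    have h2 : Continuous fun θ : ℝ => 1 / circleMap 0 R θ ^ (k + 1) :=
      continuous_const.div ((continuous_circleMap 0 R).pow _) fun θ => pow_ne_zero _ (hne θ)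
    exact ((continuous_circleMap 0 R).mul continuous_const).smul (h2.smul h1)
  · refine Eventually.of_forall fun θ _ => ?_
    rw [norm_smul, norm_smul, deriv_circleMap, norm_mul, hmem, sub_zero, norm_div, norm_pow, hmem]
    simp only [norm_one, Complex.norm_I, mul_one]
    gcongr
    exact hM n _ (hmem θ).le
  · refine Eventually.of_forall fun θ _ => ?_
    exact ((hlim _ (hmem θ)).const_smul _).const_smul _

/-- A Vitali-type theorem: a locally bounded sequence of entire functions that converges pointwise
on some circle to an entire function converges to it locally uniformly on `ℂ`. -/
theorem tendstoUniformlyOn_of_tendsto_sphere {r : ℝ} (hr : 0 < r)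
    (hF : ∀ n, Differentiable ℂ (F n)) (hf : Differentiable ℂ f)
    (hM : ∀ R : ℝ, ∃ M : ℝ, ∀ n z, ‖z‖ ≤ R → ‖F n z‖ ≤ M)
    (hlim : ∀ z, ‖z‖ = r → Tendsto (fun n => F n z) atTop (𝓝 (f z)))
    {K : Set ℂ} (hK : IsCompact K) :
    TendstoUniformlyOn F f atTop K := by
  obtain ⟨M₀, hM₀⟩ := hM r
  have hcoef := tendsto_iteratedDeriv_of_tendsto_sphere hr hF hf hM₀ hlim
  obtain ⟨R, hR, hKR⟩ := hK.isBounded.subset_closedBall_lt 0 0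
  obtain ⟨M, hM⟩ := hM (2 * R)
  obtain ⟨M', hM'⟩ := (isCompact_closedBall (0 : ℂ) (2 * R)).exists_bound_of_continuousOn
    hf.continuous.continuousOn
  -- Cauchy's estimate on the circle of radius `2 * R` beats the growth `R ^ k` geometrically
  have hbd : ∀ (g : ℂ → ℂ) (B : ℝ), Differentiable ℂ g → (∀ z, ‖z‖ ≤ 2 * R → ‖g z‖ ≤ B) →
      ∀ k : ℕ, ‖(k.factorial : ℂ)⁻¹ * iteratedDeriv k g 0‖ * R ^ k ≤ B * (1 / 2) ^ k := by
    intro g B hg hB k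
    have h := Complex.norm_iteratedDeriv_le_of_forall_mem_sphere_norm_le k
      (by positivity : 0 < 2 * R) (hg.diffContOnCl (s := Metric.ball (0 : ℂ) (2 * R)))
      (fun z hz => hB z (mem_sphere_zero_iff_norm.1 hz).le)
    have hk : (0 : ℝ) < k.factorial := by exact_mod_cast k.factorial_pos
    rw [norm_mul, norm_inv, Complex.norm_natCast]
    calc (k.factorial : ℝ)⁻¹ * ‖iteratedDeriv k g 0‖ * R ^ k
        ≤ (k.factorial : ℝ)⁻¹ * (k.factorial * B / (2 * R) ^ k) * R ^ k := by gcongr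
      _ = B * (1 / 2) ^ k := by
        rw [mul_pow, div_pow, one_pow]
        field_simp
  set d : ℕ → ℕ → ℝ := fun n k =>
    ‖(k.factorial : ℂ)⁻¹ * iteratedDeriv k (F n) 0 -
      (k.factorial : ℂ)⁻¹ * iteratedDeriv k f 0‖ * R ^ k with hd
  have hdb : ∀ n k, d n k ≤ (M + M') * (1 / 2) ^ k := fun n k => by
    have h1 := hbd (F n) M (hF n) (hM n) k
    have h2 := hbd f M' hf (fun z hz => hM' z (by simpa using hz)) k
    calc d n k ≤ (‖(k.factorial : ℂ)⁻¹ * iteratedDeriv k (F n) 0‖ +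
        ‖(k.factorial : ℂ)⁻¹ * iteratedDeriv k f 0‖) * R ^ k := by
          simp only [hd]
          gcongr
          exact norm_sub_le _ _
      _ ≤ _ := by linarith
  have hgeo : Summable fun k : ℕ => (M + M') * (1 / 2 : ℝ) ^ k :=
    (summable_geometric_of_lt_one (by norm_num) (by norm_num)).mul_left _
  have hd0 : ∀ n k, 0 ≤ d n k := fun n k => by positivity
  have hdsum : ∀ n, Summable (d n) := fun n => hgeo.of_nonneg_of_le (hd0 n) (hdb n)
  have hto : Tendsto (fun n => ∑' k, d n k) atTop (𝓝 0) := by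
    have := tendsto_tsum_of_dominated_convergence (f := d) (g := fun _ => (0 : ℝ)) (𝓕 := atTop)
      hgeo (fun k => ?_) (Eventually.of_forall fun n k => ?_)
    · simpa using this
    · have h1 := ((hcoef k).const_mul (k.factorial : ℂ)⁻¹).sub_const
        ((k.factorial : ℂ)⁻¹ * iteratedDeriv k f 0)
      rw [sub_self] at h1
      simpa [hd] using h1.norm.mul_const (R ^ k)
    · rw [Real.norm_of_nonneg (hd0 n k)]
      exact hdb n k
  rw [Metric.tendstoUniformlyOn_iff]
  intro ε hε
  filter_upwards [hto.eventually_lt_const hε] with n hn z hz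
  have hzR : ‖z‖ ≤ R := by simpa using hKR hz
  refine lt_of_le_of_lt ?_ hn
  have e1 := Complex.hasSum_taylorSeries_of_entire (hF n) 0 z
  have e2 := Complex.hasSum_taylorSeries_of_entire hf 0 z
  rw [dist_comm, dist_eq_norm, ← (e1.sub e2).tsum_eq]
  refine tsum_of_norm_bounded (hdsum n).hasSum fun k => ?_
  have : (k.factorial : ℂ)⁻¹ • (z - 0) ^ k • iteratedDeriv k (F n) 0 -
      (k.factorial : ℂ)⁻¹ • (z - 0) ^ k • iteratedDeriv k f 0 =
      ((k.factorial : ℂ)⁻¹ * iteratedDeriv k (F n) 0 -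
      (k.factorial : ℂ)⁻¹ * iteratedDeriv k f 0) * z ^ k := by
    simp only [smul_eq_mul, sub_zero]
    ring
  rw [this, norm_mul, norm_pow]
  simp only [hd]
  gcongr

end Convergence

/-! ### Hilbert–Schmidt operators and eigenbases -/

theorem Orthonormal.countable {E : Type*} [NormedAddCommGroup E] [InnerProductSpace ℂ E]
    [TopologicalSpace.SeparableSpace E] {ι : Type*} {v : ι → E}
    (hv : Orthonormal ℂ v) : Countable ι := by
  refine Pairwise.countable_of_isOpen_disjoint (s := fun i => Metric.ball (v i) (1 / 2))
    (fun i j hij => Metric.ball_disjoint_ball ?_) (fun _ => Metric.isOpen_ball)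
    fun i => ⟨v i, Metric.mem_ball_self (by norm_num)⟩
  have h : ‖v i - v j‖ ^ 2 = 2 := by
    rw [@norm_sub_sq ℂ, hv.1 i, hv.1 j, hv.2 hij]
    norm_num
  rw [dist_eq_norm]
  nlinarith [norm_nonneg (v i - v j)]

section Hilbert

variable {E : Type*} [NormedAddCommGroup E] [InnerProductSpace ℂ E] [CompleteSpace E]

/-- Hilbert–Schmidt operators are compact: they are limits in operator norm of the finite sums of
the rank-one operators `⟪b i, ·⟫ T (b i)`. -/
theorem isCompactOperator_of_summable_norm_sq {ι : Type*} (b : HilbertBasis ι ℂ E)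
    (T : E →L[ℂ] E) (h : Summable fun i => ‖T (b i)‖ ^ 2) : IsCompactOperator T := by
  set R : ι → E →L[ℂ] E := fun i => (innerSL ℂ (b i)).smulRight (T (b i)) with hR
  have hRs : ∀ (t : Finset ι), ‖∑ i ∈ t, R i‖ ≤ √(∑ i ∈ t, ‖T (b i)‖ ^ 2) := fun t => by
    refine ContinuousLinearMap.opNorm_le_bound _ (Real.sqrt_nonneg _) fun x => ?_
    rw [sum_apply]
    calc ‖∑ i ∈ t, R i x‖ ≤ ∑ i ∈ t, ‖T (b i)‖ * ‖inner ℂ (b i) x‖ := by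
          refine (norm_sum_le _ _).trans (le_of_eq (Finset.sum_congr rfl fun i _ => ?_))
          simp only [hR, ContinuousLinearMap.smulRight_apply, innerSL_apply_apply, norm_smul]
          ring
      _ ≤ √(∑ i ∈ t, ‖T (b i)‖ ^ 2) * √(∑ i ∈ t, ‖inner ℂ (b i) x‖ ^ 2) :=
          Real.sum_mul_le_sqrt_mul_sqrt _ _ _
      _ ≤ √(∑ i ∈ t, ‖T (b i)‖ ^ 2) * ‖x‖ := by
          gcongr
          exact (Real.sqrt_le_sqrt (b.orthonormal.sum_inner_products_le x)).trans_eq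
            (Real.sqrt_sq (norm_nonneg _))
  have hsum : Summable R := by
    -- Cauchy's criterion in operator norm
    rw [summable_iff_vanishing_norm]
    intro ε hε
    obtain ⟨s, hs⟩ := summable_iff_vanishing_norm.1 h (ε ^ 2) (by positivity)
    refine ⟨s, fun t ht => (hRs t).trans_lt ?_⟩
    rw [Real.sqrt_lt' hε]
    exact (le_abs_self _).trans_lt (hs t ht)
  have hT : ∑' i, R i = T := by
    ext x
    have h1 : HasSum (fun i => R i x) ((∑' i, R i) x) :=
      hsum.hasSum.mapL (ContinuousLinearMap.apply ℂ E x)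
    have h2 : HasSum (fun i => R i x) (T x) := by
      refine ((b.hasSum_repr x).mapL T).congr_fun fun i => ?_
      simp [hR, b.repr_apply_apply]
    exact h1.unique h2
  refine isCompactOperator_of_tendsto (hT ▸ hsum.hasSum) (Eventually.of_forall fun s => ?_)
  refine Submodule.sum_mem (compactOperator (RingHom.id ℂ) E E) fun i _ => ?_
  have h1 : IsCompactOperator (ContinuousLinearMap.toSpanSingleton ℂ (T (b i))) :=
    isCompactOperator_of_locallyCompactSpace_rng _
  exact h1.comp_clm (innerSL ℂ (b i))

/-- A compact self-adjoint operator has a Hilbert basis of eigenvectors, indexed by pairs of a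
number `μ` and an element of a Hilbert basis of the eigenspace of `μ`. -/
theorem exists_hilbertBasis_eigenvectors {T : E →L[ℂ] E} (hT : IsCompactOperator T)
    (hT' : (T : Module.End ℂ E).IsSymmetric) :
    ∃ (s : ∀ μ : ℂ, Set (Module.End.eigenspace (T : Module.End ℂ E) μ))
      (b : HilbertBasis (Σ μ : ℂ, s μ) ℂ E), (∀ i, T (b i) = i.1 • b i) ∧
      ∀ μ ≠ 0, (s μ).Finite ∧
        Nat.card (s μ) = Module.finrank ℂ (Module.End.eigenspace (T : Module.End ℂ E) μ) := by
  have hcl : ∀ μ : ℂ, CompleteSpace (Module.End.eigenspace (T : Module.End ℂ E) μ) := fun μ => by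
    refine IsClosed.completeSpace_coe (hs := ?_)
    have : (Module.End.eigenspace (T : Module.End ℂ E) μ : Set E) = {x | T x = μ • x} := by
      ext x
      simp
    rw [this]
    exact isClosed_eq T.continuous (continuous_const_smul μ)
  choose s b hb using fun μ : ℂ =>
    exists_hilbertBasis ℂ (Module.End.eigenspace (T : Module.End ℂ E) μ)
  have ho := hT'.orthogonalFamily_eigenspaces.orthonormal_sigma_orthonormal
    (v_family := fun μ => b μ) fun μ => (b μ).orthonormal
  refine ⟨s, HilbertBasis.mkOfOrthogonalEqBot ho ?_, fun i => ?_, fun μ hμ => ?_⟩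
  · rw [Submodule.eq_bot_iff]
    intro x hx
    have hx' : x ∈ (⨆ μ, Module.End.eigenspace (T : Module.End ℂ E) μ)ᗮ := by
      rw [← Submodule.iInf_orthogonal, Submodule.mem_iInf]
      intro μ
      rw [Submodule.mem_orthogonal]
      intro v hv
      -- the functional `⟪x, ·⟫` vanishes on the Hilbert basis of the eigenspace, hence on it
      have h := ((b μ).hasSum_repr ⟨v, hv⟩).mapL
        ((innerSL ℂ x).comp (Module.End.eigenspace (T : Module.End ℂ E) μ).subtypeL)
      have h0 : ∀ i, ((innerSL ℂ x).comp (Module.End.eigenspace (T : Module.End ℂ E) μ).subtypeL)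
          ((b μ).repr ⟨v, hv⟩ i • b μ i) = 0 := fun i => by
        have hi := (Submodule.mem_orthogonal' _ _).1 hx _
          (Submodule.subset_span ⟨(⟨μ, i⟩ : Σ μ : ℂ, s μ), rfl⟩)
        have hi' : inner ℂ x ((b μ i : Module.End.eigenspace (T : Module.End ℂ E) μ) : E) = 0 := hi
        rw [map_smul]
        simp [hi']
      have h1 : inner ℂ x v = 0 := by
        have h2 := h.unique (hasSum_zero.congr_fun h0)
        simpa using h2
      exact inner_eq_zero_symm.1 h1
    have hbot := ContinuousLinearMap.orthogonalComplement_iSup_eigenspaces_eq_bot hT hT'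
    rw [hbot] at hx'
    simpa using hx'
  · rw [HilbertBasis.coe_mkOfOrthogonalEqBot]
    exact Module.End.mem_eigenspace_iff.1 (b i.1 i.2).2
  · have hfd := ContinuousLinearMap.finite_dimensional_eigenspace hT μ hμ
    have hfin : Finite (s μ) := (b μ).orthonormal.linearIndependent.finite
    have := Fintype.ofFinite (s μ)
    refine ⟨Set.toFinite _, ?_⟩
    rw [Nat.card_eq_fintype_card,
      Module.finrank_eq_card_basis (b μ).toOrthonormalBasis.toBasis]

end Hilbert

/-! ### The kernel operator of a graphon -/

namespace Graphon

variable (W : Graphon)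

theorem memLp_row (x : I) : MemLp (fun y => (W.toFun x y : ℂ)) 2 (volume : Measure I) := by
  refine MemLp.of_bound (Complex.measurable_ofReal.comp
    (W.measurable.comp measurable_prodMk_left)).aestronglyMeasurable 1
    (Eventually.of_forall fun y => ?_)
  rw [Complex.norm_real, Real.norm_of_nonneg (W.nonneg x y)]
  exact W.le_one x y

/-- The section `W(x, ·)` of a graphon, as a vector of `L²`. -/
def row (x : I) : Lp ℂ 2 (volume : Measure I) := (W.memLp_row x).toLp

theorem coeFn_row (x : I) : W.row x =ᵐ[volume] fun y => (W.toFun x y : ℂ) :=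
  (W.memLp_row x).coeFn_toLp

theorem norm_row_le (x : I) : ‖W.row x‖ ≤ 1 := by
  have h := Lp.norm_le_of_ae_bound (f := W.row x) zero_le_one (by
    filter_upwards [W.coeFn_row x] with y hy
    rw [hy, Complex.norm_real, Real.norm_of_nonneg (W.nonneg x y)]
    exact W.le_one x y)
  simpa [measureUnivNNReal] using h

theorem inner_row (x : I) (f : Lp ℂ 2 (volume : Measure I)) :
    inner ℂ (W.row x) f = ∫ y, (W.toFun x y : ℂ) * f y := by
  rw [L2.inner_def]
  refine integral_congr_ae ?_
  filter_upwards [W.coeFn_row x] with y hy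
  rw [hy, RCLike.inner_apply, Complex.conj_ofReal, mul_comm]

theorem kernelOp_ae_eq_inner (f : Lp ℂ 2 (volume : Measure I)) :
    W.kernelOp f =ᵐ[volume] fun x => inner ℂ (W.row x) f := by
  filter_upwards [W.kernelOp_apply_ae f] with x hx
  rw [hx, inner_row]

theorem measurable_inner_row (f : Lp ℂ 2 (volume : Measure I)) :
    StronglyMeasurable fun x => inner ℂ (W.row x) f := by
  have h : StronglyMeasurable (fun p : I × I => (W.toFun p.1 p.2 : ℂ) * f p.2) :=
    (Complex.measurable_ofReal.comp W.measurable).stronglyMeasurable.mul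
      ((Lp.stronglyMeasurable f).comp_measurable measurable_snd)
  simp_rw [inner_row]
  exact h.integral_prod_right'

theorem integrable_norm_inner_row_sq (f : Lp ℂ 2 (volume : Measure I)) :
    Integrable fun x => ‖inner ℂ (W.row x) f‖ ^ 2 := by
  refine Integrable.of_bound
    ((W.measurable_inner_row f).norm.pow 2).aestronglyMeasurable (‖f‖ ^ 2)
    (Eventually.of_forall fun x => ?_)
  rw [Real.norm_of_nonneg (sq_nonneg _)]
  gcongr
  exact (norm_inner_le_norm _ _).trans (mul_le_of_le_one_left (norm_nonneg _) (W.norm_row_le x))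

theorem norm_kernelOp_sq (f : Lp ℂ 2 (volume : Measure I)) :
    ‖W.kernelOp f‖ ^ 2 = ∫ x, ‖inner ℂ (W.row x) f‖ ^ 2 := by
  have h : ((‖W.kernelOp f‖ ^ 2 : ℝ) : ℂ) = ((∫ x, ‖inner ℂ (W.row x) f‖ ^ 2 : ℝ) : ℂ) := by
    rw [← integral_complex_ofReal, Complex.ofReal_pow]
    refine (inner_self_eq_norm_sq_to_K (𝕜 := ℂ) (W.kernelOp f)).symm.trans ?_
    rw [L2.inner_def]
    refine integral_congr_ae ?_
    filter_upwards [W.kernelOp_ae_eq_inner f] with x hx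
    rw [hx, inner_self_eq_norm_sq_to_K]
    push_cast
    rfl
  exact_mod_cast h

/-- Bessel's inequality for the rows bounds the Hilbert–Schmidt norm of the kernel operator. -/
theorem sum_norm_kernelOp_sq_le {ι : Type*} {v : ι → Lp ℂ 2 (volume : Measure I)}
    (hv : Orthonormal ℂ v) (s : Finset ι) : ∑ i ∈ s, ‖W.kernelOp (v i)‖ ^ 2 ≤ 1 := by
  simp_rw [norm_kernelOp_sq]
  rw [← integral_finsetSum _ fun i _ => W.integrable_norm_inner_row_sq (v i)]
  calc ∫ x, ∑ i ∈ s, ‖inner ℂ (W.row x) (v i)‖ ^ 2 ≤ ∫ _ : I, (1 : ℝ) := by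
        refine integral_mono (integrable_finsetSum _ fun i _ =>
          W.integrable_norm_inner_row_sq (v i)) (integrable_const _) fun x => ?_
        simp_rw [norm_inner_symm (W.row x)]
        refine (hv.sum_inner_products_le (W.row x)).trans ?_
        exact pow_le_one₀ (norm_nonneg _) (W.norm_row_le x)
    _ = 1 := by simp

theorem summable_norm_kernelOp_sq {ι : Type*} {v : ι → Lp ℂ 2 (volume : Measure I)}
    (hv : Orthonormal ℂ v) : Summable fun i => ‖W.kernelOp (v i)‖ ^ 2 :=
  summable_of_sum_le (fun _ => sq_nonneg _) (W.sum_norm_kernelOp_sq_le hv)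

theorem isCompactOperator_kernelOp : IsCompactOperator W.kernelOp := by
  obtain ⟨w, b, -⟩ := exists_hilbertBasis ℂ (Lp ℂ 2 (volume : Measure I))
  exact isCompactOperator_of_summable_norm_sq b _ (W.summable_norm_kernelOp_sq b.orthonormal)

theorem isSymmetric_kernelOp :
    (W.kernelOp : Module.End ℂ (Lp ℂ 2 (volume : Measure I))).IsSymmetric := by
  intro f g
  change inner ℂ (W.kernelOp f) g = inner ℂ f (W.kernelOp g)
  have hint : Integrable (fun p : I × I =>
      (W.toFun p.1 p.2 : ℂ) * ((starRingEnd ℂ) (f p.1) * g p.2))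
      ((volume : Measure I).prod volume) := by
    have h1 : Integrable (fun x => (starRingEnd ℂ) (f x)) (volume : Measure I) := by
      refine (integrable_coe f).congr'_enorm ?_ ?_
      · exact Complex.continuous_conj.comp_aestronglyMeasurable (integrable_coe f).1
      · exact Eventually.of_forall fun x => by simp [enorm_eq_nnnorm]
    refine (h1.mul_prod (integrable_coe g)).bdd_mul (c := 1)
      (Complex.measurable_ofReal.comp W.measurable).aestronglyMeasurable
      (Eventually.of_forall fun p => ?_)
    rw [Complex.norm_real, Real.norm_of_nonneg (W.nonneg _ _)]
    exact W.le_one _ _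
  have hl : inner ℂ (W.kernelOp f) g =
      ∫ y, ∫ x, (W.toFun x y : ℂ) * ((starRingEnd ℂ) (f x) * g y) := by
    rw [L2.inner_def]
    refine integral_congr_ae ?_
    filter_upwards [W.kernelOp_apply_ae f] with y hy
    rw [hy, RCLike.inner_apply, ← integral_conj, ← integral_const_mul]
    refine integral_congr_ae (Eventually.of_forall fun x => ?_)
    simp only [map_mul, Complex.conj_ofReal, W.symm x y]
    ring
  have hr : inner ℂ f (W.kernelOp g) =
      ∫ x, ∫ y, (W.toFun x y : ℂ) * ((starRingEnd ℂ) (f x) * g y) := by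
    rw [L2.inner_def]
    refine integral_congr_ae ?_
    filter_upwards [W.kernelOp_apply_ae g] with x hx
    rw [hx, RCLike.inner_apply, mul_comm, ← integral_const_mul]
    refine integral_congr_ae (Eventually.of_forall fun y => ?_)
    ring
  rw [hl, hr]
  exact (integral_integral_swap hint).symm

/-- The trace formula: the power sums of the eigenvalues are traces of iterated kernels. -/
theorem hasSum_eigenvalue_pow {ι : Type*}
    (b : HilbertBasis ι ℂ (Lp ℂ 2 (volume : Measure I))) {a : ι → ℂ}
    (hb : ∀ i, W.kernelOp (b i) = a i • b i) (m : ℕ) :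
    HasSum (fun i => a i ^ (m + 2)) (∫ x, inner ℂ (W.row x) ((W.kernelOp ^ m) (W.row x))) := by
  have hsymm := W.isSymmetric_kernelOp
  have hnorm : ∀ i, ‖W.kernelOp (b i)‖ = ‖a i‖ := fun i => by
    rw [hb, norm_smul, b.orthonormal.1 i, mul_one]
  have hsq := W.summable_norm_kernelOp_sq b.orthonormal
  have ha1 : ∀ i, ‖a i‖ ≤ 1 := fun i => by
    have h := W.sum_norm_kernelOp_sq_le b.orthonormal {i}
    rw [Finset.sum_singleton, hnorm] at h
    exact (sq_le_one_iff₀ (norm_nonneg _)).1 h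
  have hreal : ∀ i, (starRingEnd ℂ) (a i) = a i := fun i =>
    hsymm.conj_eigenvalue_eq_self (Module.End.hasEigenvalue_of_hasEigenvector
      ⟨Module.End.mem_eigenspace_iff.2 (hb i), b.orthonormal.ne_zero i⟩)
  have hpow : ∀ i (k : ℕ) (v : Lp ℂ 2 (volume : Measure I)),
      inner ℂ (b i) ((W.kernelOp ^ k) v) = a i ^ k * inner ℂ (b i) v := by
    intro i k v
    induction k with
    | zero => simp
    | succ k ih =>
      have h1 : inner ℂ (b i) (W.kernelOp ((W.kernelOp ^ k) v)) =
          inner ℂ (W.kernelOp (b i)) ((W.kernelOp ^ k) v) := (hsymm _ _).symm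
      rw [pow_succ', mul_apply_eq_comp, h1, hb, inner_smul_left, hreal, ih, pow_succ']
      ring
  have : Fact ((2 : ENNReal) ≠ ⊤) := ⟨by norm_num⟩
  -- integrating the eigenexpansion of the rows term by term requires countably many terms
  have hcount : Countable ι := b.orthonormal.countable
  have hterm : ∀ i x, inner ℂ (W.row x) (b i) * inner ℂ (b i) ((W.kernelOp ^ m) (W.row x)) =
      a i ^ m * ((‖inner ℂ (W.row x) (b i)‖ ^ 2 : ℝ) : ℂ) := by
    intro i x
    rw [hpow, ← inner_conj_symm (b i) (W.row x), mul_left_comm, RCLike.mul_conj]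
    push_cast
    rfl
  have hval : ∀ i, ∫ x, inner ℂ (W.row x) (b i) * inner ℂ (b i) ((W.kernelOp ^ m) (W.row x)) =
      a i ^ (m + 2) := by
    intro i
    simp_rw [hterm]
    rw [integral_const_mul, integral_complex_ofReal, ← norm_kernelOp_sq, hnorm, pow_add]
    congr 1
    have h : a i ^ 2 = a i * (starRingEnd ℂ) (a i) := by rw [hreal, sq]
    rw [h, RCLike.mul_conj]
    push_cast
    rfl
  have hint : ∀ i, Integrable fun x =>
      inner ℂ (W.row x) (b i) * inner ℂ (b i) ((W.kernelOp ^ m) (W.row x)) := by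
    intro i
    simp_rw [hterm]
    exact (W.integrable_norm_inner_row_sq (b i)).ofReal.const_mul _
  have h := hasSum_integral_of_summable_integral_norm hint (hsq.of_nonneg_of_le
    (fun i => integral_nonneg fun x => norm_nonneg _) fun i => ?_)
  · simp_rw [hval, b.tsum_inner_mul_inner] at h
    exact h
  · rw [norm_kernelOp_sq]
    refine integral_mono (hint i).norm (W.integrable_norm_inner_row_sq (b i)) fun x => ?_
    simp only [hterm]
    rw [norm_mul, norm_pow, Complex.norm_real, Real.norm_of_nonneg (sq_nonneg _)]
    exact mul_le_of_le_one_left (sq_nonneg _) (pow_le_one₀ (norm_nonneg _) (ha1 i))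

end Graphon

/-! ### Products along paths and cycles -/

section Path

variable {R X : Type*} [CommMonoid R]

/-- The product of a kernel `f` along the path `x, u 0, …, u (m - 1), y`. -/
def pathProd (f : X → X → R) {m : ℕ} (x : X) (u : Fin m → X) (y : X) : R :=
  ∏ i : Fin (m + 1), f ((Fin.cons x u : Fin (m + 1) → X) i) ((Fin.snoc u y : Fin (m + 1) → X) i)

theorem pathProd_zero (f : X → X → R) (x : X) (u : Fin 0 → X) (y : X) :
    pathProd f x u y = f x y := by
  simp [pathProd, Fin.snoc]

theorem pathProd_cons (f : X → X → R) {m : ℕ} (x z : X) (u : Fin m → X) (y : X) :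
    pathProd f x (Fin.cons z u : Fin (m + 1) → X) y = f x z * pathProd f z u y := by
  rw [pathProd, Fin.prod_univ_succ, pathProd, ← Fin.cons_snoc_eq_snoc_cons]
  simp

/-- A path that returns to its starting point is a cyclic product. -/
theorem pathProd_self (f : X → X → R) {m : ℕ} (x : X) (u : Fin m → X) :
    pathProd f x u x = ∏ i : Fin (m + 1), f ((Fin.cons x u : Fin (m + 1) → X) i)
      ((Fin.cons x u : Fin (m + 1) → X) (i + 1)) := by
  refine Finset.prod_congr rfl fun i _ => ?_
  congr 1
  induction i using Fin.lastCases with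
  | last => simp
  | cast j => simp

/-- Over the edges of a cycle, a symmetric product is the cyclic product. -/
theorem prod_cycleGraph_edges {m : ℕ} (g : Fin (m + 3) → Fin (m + 3) → R)
    (hg : ∀ i j, g i j = g j i)
    [DecidablePred fun p : Fin (m + 3) × Fin (m + 3) =>
      p.1 < p.2 ∧ (SimpleGraph.cycleGraph (m + 3)).Adj p.1 p.2] :
    ∏ p : Fin (m + 3) × Fin (m + 3) with
      p.1 < p.2 ∧ (SimpleGraph.cycleGraph (m + 3)).Adj p.1 p.2, g p.1 p.2 =
    ∏ i : Fin (m + 3), g i (i + 1) := by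
  -- the edge that closes the cycle is `(0, m + 2)`, all others are `(j, j + 1)`
  have hset : (Finset.univ.filter fun p : Fin (m + 3) × Fin (m + 3) =>
      p.1 < p.2 ∧ (SimpleGraph.cycleGraph (m + 3)).Adj p.1 p.2) =
      insert (0, Fin.last (m + 2))
        (Finset.univ.image fun j : Fin (m + 2) => (j.castSucc, j.succ)) := by
    ext ⟨p, q⟩
    simp only [Finset.mem_filter, Finset.mem_univ, true_and, Finset.mem_insert, Finset.mem_image,
      Prod.mk.injEq, SimpleGraph.cycleGraph_adj']
    have hadj : p < q → ((p - q).val = 1 ∨ (q - p).val = 1 ↔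
        q.val = p.val + 1 ∨ (p.val = 0 ∧ q.val = m + 2)) := by
      intro h
      have hv : p.val < q.val := h
      have h1 : (q - p).val = q.val - p.val := Fin.sub_val_of_le h.le
      have h2 : (p - q).val = m + 3 + p.val - q.val := by
        rw [Fin.sub_def]
        simp only
        rw [Nat.mod_eq_of_lt (by omega)]
        omega
      omega
    constructor
    · rintro ⟨h, h'⟩
      rcases (hadj h).1 h' with h1 | ⟨h1, h2⟩
      · right
        refine ⟨⟨p.val, by omega⟩, ?_, ?_⟩
        · ext; simp
        · ext; simp [h1]
      · left
        exact ⟨Fin.ext h1, Fin.ext h2⟩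
    · rintro (⟨rfl, rfl⟩ | ⟨j, rfl, rfl⟩)
      · have h : (0 : Fin (m + 3)) < Fin.last (m + 2) := Fin.last_pos
        exact ⟨h, (hadj h).2 (Or.inr (by simp))⟩
      · have h := Fin.castSucc_lt_succ (i := j)
        exact ⟨h, (hadj h).2 (Or.inl (by simp))⟩
  rw [hset, Finset.prod_insert, Finset.prod_image,
    Fin.prod_univ_castSucc fun i => g i (i + 1), mul_comm]
  · congr 1
    · exact Finset.prod_congr rfl fun j _ => by simp
    · simp [hg]
  · intro i _ j _ h
    simpa using h
  · simp only [Finset.mem_image, Finset.mem_univ, true_and, Prod.mk.injEq, not_exists, not_and]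
    intro j h1 h2
    have h3 := congrArg Fin.val h1
    have h4 := congrArg Fin.val h2
    simp only [Fin.val_castSucc, Fin.val_succ, Fin.val_zero, Fin.val_last] at h3 h4
    omega

theorem prod_cycleGraph_two_edges (g : Fin 2 → Fin 2 → R)
    [DecidablePred fun p : Fin 2 × Fin 2 =>
      p.1 < p.2 ∧ (SimpleGraph.cycleGraph 2).Adj p.1 p.2] :
    ∏ p : Fin 2 × Fin 2 with
      p.1 < p.2 ∧ (SimpleGraph.cycleGraph 2).Adj p.1 p.2, g p.1 p.2 = g 0 1 := by
  have hset : (Finset.univ.filter fun p : Fin 2 × Fin 2 =>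
      p.1 < p.2 ∧ (SimpleGraph.cycleGraph 2).Adj p.1 p.2) = {(0, 1)} := by
    ext ⟨p, q⟩
    simp only [Finset.mem_filter, Finset.mem_univ, true_and, Finset.mem_singleton,
      Prod.mk.injEq, SimpleGraph.cycleGraph_two_eq_top, SimpleGraph.top_adj]
    revert p q
    decide
  rw [hset, Finset.prod_singleton]

end Path

/-! ### Densities of cycles in finite graphs -/

section Finite

variable {V : Type*} [Fintype V]

theorem matrix_pow_apply_eq_sum_pathProd [DecidableEq V] {R : Type*} [CommRing R]
    (A : Matrix V V R) (m : ℕ)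
    (x y : V) : (A ^ (m + 1)) x y = ∑ u : Fin m → V, pathProd A x u y := by
  induction m generalizing x with
  | zero =>
    rw [Fintype.sum_unique, zero_add, pow_one]
    exact (pathProd_zero A x _ y).symm
  | succ m ih =>
    rw [pow_succ', Matrix.mul_apply, ← (Fin.consEquiv fun _ : Fin (m + 1) => V).sum_comp,
      Fintype.sum_prod_type]
    refine Finset.sum_congr rfl fun z _ => ?_
    rw [ih, Finset.mul_sum]
    refine Finset.sum_congr rfl fun u _ => ?_
    exact (pathProd_cons A x z u y).symm

theorem trace_pow_eq_sum_prod [DecidableEq V] {R : Type*} [CommRing R] (A : Matrix V V R) (m : ℕ) :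
    (A ^ (m + 1)).trace = ∑ v : Fin (m + 1) → V, ∏ i, A (v i) (v (i + 1)) := by
  rw [Matrix.trace, ← (Fin.consEquiv fun _ : Fin (m + 1) => V).sum_comp, Fintype.sum_prod_type]
  refine Finset.sum_congr rfl fun x _ => ?_
  rw [Matrix.diag_apply, matrix_pow_apply_eq_sum_pathProd]
  exact Finset.sum_congr rfl fun u _ => pathProd_self A x u

/-- The edges of `F` are listed as pairs `p` with `p.1 < p.2`, as in the density of a graphon. -/
theorem card_hom_eq_sum_prod {R : Type*} [CommRing R] {k : ℕ} (F : SimpleGraph (Fin k))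
    (G : SimpleGraph V) [DecidableRel G.Adj]
    [DecidablePred fun p : Fin k × Fin k => p.1 < p.2 ∧ F.Adj p.1 p.2] :
    (Nat.card (F →g G) : R) = ∑ v : Fin k → V,
      ∏ p : Fin k × Fin k with p.1 < p.2 ∧ F.Adj p.1 p.2, G.adjMatrix R (v p.1) (v p.2) := by
  classical
  have e : (F →g G) ≃ {v : Fin k → V // ∀ p ∈ Finset.univ.filter
      fun p : Fin k × Fin k => p.1 < p.2 ∧ F.Adj p.1 p.2, G.Adj (v p.1) (v p.2)} :=
    { toFun := fun φ => ⟨φ, fun p hp => φ.map_rel (Finset.mem_filter.1 hp).2.2⟩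
      invFun := fun v => ⟨v.1, fun {a b} hab => by
        rcases lt_trichotomy a b with h | h | h
        · exact v.2 (a, b) (by simp [h, hab])
        · exact absurd h hab.ne
        · exact (v.2 (b, a) (by simp [h, hab.symm])).symm⟩
      left_inv := fun φ => rfl
      right_inv := fun v => rfl }
  simp_rw [SimpleGraph.adjMatrix_apply, Finset.prod_boole]
  rw [Nat.card_congr e, Nat.card_eq_fintype_card, Fintype.card_subtype, Finset.card_filter]
  push_cast
  exact Finset.sum_congr rfl fun v _ => by congr

/-- The traces of the powers of the normalized adjacency matrix are densities of cycles; a cycle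
of length two is an edge. -/
theorem trace_adjMatrix_pow_eq_homDensity [DecidableEq V] (G : SimpleGraph V)
    [DecidableRel G.Adj] (m : ℕ) :
    ((((Fintype.card V : ℂ)⁻¹) • G.adjMatrix ℂ) ^ (m + 2)).trace =
      (((SimpleGraph.cycleGraph (m + 2)).homDensity G : ℝ) : ℂ) := by
  classical
  have hcard : ((G.adjMatrix ℂ) ^ (m + 2)).trace =
      (Nat.card (SimpleGraph.cycleGraph (m + 2) →g G) : ℂ) := by
    rw [card_hom_eq_sum_prod, trace_pow_eq_sum_prod]
    refine Finset.sum_congr rfl fun v _ => ?_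
    rcases m with _ | m
    · rw [prod_cycleGraph_two_edges fun i j => G.adjMatrix ℂ (v i) (v j), Fin.prod_univ_two]
      simp only [SimpleGraph.adjMatrix_apply]
      by_cases h : G.Adj (v 0) (v 1)
      · simp [h, h.symm]
      · simp [h]
    · rw [prod_cycleGraph_edges fun i j => G.adjMatrix ℂ (v i) (v j)]
      intro i j
      simp [SimpleGraph.adjMatrix_apply, G.adj_comm]
  rw [_root_.smul_pow, Matrix.trace_smul, hcard, SimpleGraph.homDensity, smul_eq_mul, inv_pow]
  push_cast
  rw [div_eq_inv_mul]

end Finite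

/-! ### Densities of cycles in graphons -/

namespace Graphon

variable (W : Graphon)

theorem integral_fin_succ {m : ℕ} {g : (Fin (m + 1) → I) → ℝ} (hg : Integrable g) :
    ∫ v, g v = ∫ x : I, ∫ u : Fin m → I, g (Fin.cons x u : Fin (m + 1) → I) := by
  have hmp := (volume_preserving_piFinSuccAbove (fun _ : Fin (m + 1) => I) 0).symm
  have h1 := hmp.integral_comp
    (MeasurableEquiv.piFinSuccAbove (fun _ : Fin (m + 1) => I) 0).symm.measurableEmbedding g
  rw [← h1]
  have h2 : ∀ p : I × (Fin m → I),
      (MeasurableEquiv.piFinSuccAbove (fun _ : Fin (m + 1) => I) 0).symm p =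
      (Fin.cons p.1 p.2 : Fin (m + 1) → I) := fun p => by
    ext i
    simp [MeasurableEquiv.piFinSuccAbove, Fin.insertNthEquiv]
  have h3 := (hmp.integrable_comp_emb (MeasurableEquiv.piFinSuccAbove
    (fun _ : Fin (m + 1) => I) 0).symm.measurableEmbedding).2 hg
  simp only [Function.comp_def, h2] at h3
  simp_rw [h2]
  exact integral_prod _ h3

theorem measurable_pathProd {m : ℕ} :
    Measurable fun p : I × (Fin m → I) × I => pathProd W.toFun p.1 p.2.1 p.2.2 := by
  have hc : ∀ i : Fin (m + 1), Measurable fun p : I × (Fin m → I) × I =>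
      (Fin.cons p.1 p.2.1 : Fin (m + 1) → I) i := by
    refine Fin.cases ?_ fun j => ?_
    · simp only [Fin.cons_zero]
      exact measurable_fst
    · simp only [Fin.cons_succ]
      exact (measurable_pi_apply j).comp (measurable_fst.comp measurable_snd)
  have hs : ∀ i : Fin (m + 1), Measurable fun p : I × (Fin m → I) × I =>
      (Fin.snoc p.2.1 p.2.2 : Fin (m + 1) → I) i := by
    refine Fin.lastCases ?_ fun j => ?_
    · simp only [Fin.snoc_last]
      exact measurable_snd.comp measurable_snd
    · simp only [Fin.snoc_castSucc]
      exact (measurable_pi_apply j).comp (measurable_fst.comp measurable_snd)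
  exact Finset.measurable_fun_prod _ fun i _ => W.measurable.comp ((hc i).prodMk (hs i))

theorem pathProd_nonneg {m : ℕ} (x : I) (u : Fin m → I) (y : I) : 0 ≤ pathProd W.toFun x u y :=
  Finset.prod_nonneg fun _ _ => W.nonneg _ _

theorem pathProd_le_one {m : ℕ} (x : I) (u : Fin m → I) (y : I) : pathProd W.toFun x u y ≤ 1 :=
  Finset.prod_le_one (fun _ _ => W.nonneg _ _) fun _ _ => W.le_one _ _

theorem integrable_pathProd {m : ℕ} (x y : I) :
    Integrable fun u : Fin m → I => pathProd W.toFun x u y :=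
  Integrable.of_bound (W.measurable_pathProd.comp (measurable_const.prodMk
    (measurable_id.prodMk measurable_const))).aestronglyMeasurable 1
    (Eventually.of_forall fun u => by
      rw [Real.norm_of_nonneg (W.pathProd_nonneg x u y)]
      exact W.pathProd_le_one x u y)

/-- The iterated kernel: `iterKernel m x y` integrates over all paths from `x` to `y` with `m`
inner points. -/
def iterKernel (m : ℕ) (x y : I) : ℝ := ∫ u : Fin m → I, pathProd W.toFun x u y

theorem iterKernel_zero (x y : I) : W.iterKernel 0 x y = W.toFun x y := by
  simp [iterKernel, pathProd_zero]

theorem iterKernel_succ (m : ℕ) (x y : I) :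
    W.iterKernel (m + 1) x y = ∫ z, W.toFun x z * W.iterKernel m z y := by
  rw [iterKernel, integral_fin_succ (W.integrable_pathProd x y)]
  simp_rw [pathProd_cons, integral_const_mul]
  rfl

theorem kernelOp_pow_row_ae (m : ℕ) (y : I) :
    (W.kernelOp ^ m) (W.row y) =ᵐ[volume] fun x => (W.iterKernel m x y : ℂ) := by
  induction m with
  | zero =>
    filter_upwards [W.coeFn_row y] with x hx
    rw [pow_zero, one_apply_eq_self, hx, iterKernel_zero, W.symm]
  | succ m ih =>
    rw [pow_succ', mul_apply_eq_comp]
    filter_upwards [W.kernelOp_apply_ae ((W.kernelOp ^ m) (W.row y))] with x hx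
    rw [hx, iterKernel_succ, ← integral_complex_ofReal]
    refine integral_congr_ae ?_
    filter_upwards [ih] with z hz
    rw [hz]
    push_cast
    rfl

/-- Pairing with a row gives the iterated kernel at every point, in particular on the diagonal,
where `kernelOp_pow_row_ae` says nothing. -/
theorem inner_row_kernelOp_pow_row (m : ℕ) (x y : I) :
    inner ℂ (W.row x) ((W.kernelOp ^ m) (W.row y)) = (W.iterKernel (m + 1) x y : ℂ) := by
  rw [inner_row, iterKernel_succ, ← integral_complex_ofReal]
  refine integral_congr_ae ?_
  filter_upwards [W.kernelOp_pow_row_ae m y] with z hz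
  rw [hz]
  push_cast
  rfl

theorem homDensity_cycleGraph (m : ℕ) :
    W.homDensity (SimpleGraph.cycleGraph (m + 3)) = ∫ x, W.iterKernel (m + 2) x x := by
  classical
  have h1 : ∀ v : Fin (m + 3) → I, (∏ p : Fin (m + 3) × Fin (m + 3) with
      p.1 < p.2 ∧ (SimpleGraph.cycleGraph (m + 3)).Adj p.1 p.2, W.toFun (v p.1) (v p.2)) =
      ∏ i, W.toFun (v i) (v (i + 1)) := fun v =>
    prod_cycleGraph_edges (fun i j => W.toFun (v i) (v j)) fun i j => W.symm _ _
  have hint : Integrable fun v : Fin (m + 3) → I => ∏ i, W.toFun (v i) (v (i + 1)) := by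
    refine Integrable.of_bound (Measurable.aestronglyMeasurable ?_) 1
      (Eventually.of_forall fun v => ?_)
    · exact Finset.measurable_fun_prod _ fun i _ => W.measurable.comp
        (f := fun v : Fin (m + 3) → I => (v i, v (i + 1)))
        ((measurable_pi_apply i).prodMk (measurable_pi_apply (i + 1)))
    · rw [Real.norm_of_nonneg (Finset.prod_nonneg fun _ _ => W.nonneg _ _)]
      exact Finset.prod_le_one (fun _ _ => W.nonneg _ _) fun _ _ => W.le_one _ _
  have h2 : W.homDensity (SimpleGraph.cycleGraph (m + 3)) =
      ∫ v : Fin (m + 3) → I, ∏ i, W.toFun (v i) (v (i + 1)) := by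
    unfold homDensity
    refine integral_congr_ae (Eventually.of_forall fun v => ?_)
    convert h1 v
  rw [h2, integral_fin_succ hint]
  simp_rw [← pathProd_self]
  rfl

theorem homDensity_cycleGraph_two :
    W.homDensity (SimpleGraph.cycleGraph 2) = W.norm1 := by
  classical
  have h1 : ∀ v : Fin 2 → I, (∏ p : Fin 2 × Fin 2 with
      p.1 < p.2 ∧ (SimpleGraph.cycleGraph 2).Adj p.1 p.2, W.toFun (v p.1) (v p.2)) =
      W.toFun (v 0) (v 1) := fun v =>
    prod_cycleGraph_two_edges (fun i j => W.toFun (v i) (v j))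
  have h2 : W.homDensity (SimpleGraph.cycleGraph 2) =
      ∫ v : Fin 2 → I, W.toFun (v 0) (v 1) := by
    unfold homDensity
    refine integral_congr_ae (Eventually.of_forall fun v => ?_)
    convert h1 v
  have h3 := (volume_preserving_finTwoArrow I).integral_comp
    MeasurableEquiv.finTwoArrow.measurableEmbedding fun p : I × I => W.toFun p.1 p.2
  rw [h2, norm1]
  simp_rw [abs_of_nonneg (W.nonneg _ _)]
  rw [← h3]
  rfl

/-- The second power sum of the eigenvalues is not the edge density, but `‖W‖₂²`. -/
theorem norm2_sq : W.norm2 ^ 2 = ∫ x, W.iterKernel 1 x x := by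
  rw [norm2, Real.sq_sqrt (integral_nonneg fun _ => sq_nonneg _)]
  have hint : Integrable (fun p : I × I => W.toFun p.1 p.2 ^ 2)
      ((volume : Measure I).prod volume) := by
    refine Integrable.of_bound (W.measurable.pow_const 2).aestronglyMeasurable 1
      (Eventually.of_forall fun p => ?_)
    rw [Real.norm_of_nonneg (sq_nonneg _)]
    exact pow_le_one₀ (W.nonneg _ _) (W.le_one _ _)
  refine (integral_prod _ hint).trans (integral_congr_ae (Eventually.of_forall fun x => ?_))
  simp only [iterKernel_succ, iterKernel_zero]
  refine integral_congr_ae (Eventually.of_forall fun y => ?_)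
  simp only [W.symm y x, sq]

end Graphon

/-! ### The polynomial of a finite graph -/

namespace SimpleGraph

theorem isHermitian_smul_adjMatrix {V : Type*} [Fintype V]
    (G : SimpleGraph V) [DecidableRel G.Adj] :
    (((Fintype.card V : ℂ)⁻¹) • G.adjMatrix ℂ).IsHermitian := by
  ext i j
  by_cases hij : G.Adj i j <;> simp [hij, G.adj_comm j i]

theorem homDensity_nonneg {k : ℕ} (F : SimpleGraph (Fin k)) {V : Type*} [Fintype V]
    (G : SimpleGraph V) :
    0 ≤ F.homDensity G := by
  unfold homDensity
  positivity

theorem homDensity_le_one {k : ℕ} (F : SimpleGraph (Fin k)) {V : Type*} [Fintype V]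
    (G : SimpleGraph V) :
    F.homDensity G ≤ 1 := by
  refine div_le_one_of_le₀ ?_ (by positivity)
  have h : Nat.card (F →g G) ≤ Nat.card (Fin k → V) :=
    Nat.card_le_card_of_injective (fun φ : F →g G => (φ : Fin k → V)) DFunLike.coe_injective
  rw [Nat.card_eq_fintype_card (α := Fin k → V), Fintype.card_fun, Fintype.card_fin] at h
  exact_mod_cast h

end SimpleGraph

section Finite

variable {V : Type*} [Fintype V] [DecidableEq V]

theorem Matrix.IsHermitian.eval_charpolyRev_eq_prod {M : Matrix V V ℂ} (hM : M.IsHermitian)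
    (z : ℂ) : M.charpolyRev.eval z = ∏ i, (1 - (hM.eigenvalues i : ℂ) * z) := by
  have h1 : M.charpolyRev.eval z = (1 - z • M).det := by
    rw [Matrix.charpolyRev, ← Polynomial.coe_evalRingHom, RingHom.map_det]
    congr 1
    ext i j
    by_cases hij : i = j
    · subst hij
      simp
      exact mul_comm _ _
    · simp [Matrix.one_apply_ne, hij]
      exact mul_comm _ _
  set φ := Unitary.conjStarAlgAut ℂ (Matrix V V ℂ) hM.eigenvectorUnitary
  set D : Matrix V V ℂ := Matrix.diagonal (RCLike.ofReal ∘ hM.eigenvalues)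
  have hD : M = φ D := hM.spectral_theorem
  have h2 : 1 - z • M = φ (1 - z • D) := by
    rw [map_sub, map_one, map_smul, ← hD]
  have h3 : ∀ X : Matrix V V ℂ, (φ X).det = X.det := fun X => by
    rw [Unitary.conjStarAlgAut_apply, Matrix.det_mul_right_comm]
    simp
  have h4 : 1 - z • D = Matrix.diagonal fun i => 1 - (hM.eigenvalues i : ℂ) * z := by
    ext i j
    by_cases hij : i = j
    · subst hij
      simp [D, mul_comm]
    · simp [D, hij]
  rw [h1, h2, h3, h4, Matrix.det_diagonal]

theorem Matrix.IsHermitian.trace_pow_eq_sum {M : Matrix V V ℂ} (hM : M.IsHermitian) (k : ℕ) :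
    (M ^ k).trace = ∑ i, (hM.eigenvalues i : ℂ) ^ k := by
  conv_lhs => rw [hM.spectral_theorem, ← map_pow, Unitary.conjStarAlgAut_apply,
    Matrix.trace_mul_comm, ← mul_assoc]
  simp [Matrix.diagonal_pow, Matrix.trace_diagonal]

theorem Matrix.map_charpolyRev {R S : Type*} [CommRing R] [CommRing S] (f : R →+* S)
    (M : Matrix V V R) : M.charpolyRev.map f = (M.map f).charpolyRev := by
  rw [Matrix.charpolyRev, Matrix.charpolyRev, ← Polynomial.coe_mapRingHom, RingHom.map_det]
  congr 1
  ext1 i j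
  by_cases hij : i = j
  · subst hij
    simp
  · simp [Matrix.one_apply_ne, hij]

namespace SimpleGraph

/-- The eigenvalues of the normalized adjacency matrix. -/
def normEigenvalues (G : SimpleGraph V) [DecidableRel G.Adj] : V → ℝ :=
  G.isHermitian_smul_adjMatrix.eigenvalues

variable (G : SimpleGraph V) [DecidableRel G.Adj]

theorem sum_normEigenvalues_pow (m : ℕ) :
    ∑ i, (G.normEigenvalues i : ℂ) ^ (m + 2) =
      (((cycleGraph (m + 2)).homDensity G : ℝ) : ℂ) := by
  rw [← trace_adjMatrix_pow_eq_homDensity]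
  exact (G.isHermitian_smul_adjMatrix.trace_pow_eq_sum _).symm

theorem sum_norm_normEigenvalues_sq_le : ∑ i, ‖(G.normEigenvalues i : ℂ)‖ ^ 2 ≤ 1 := by
  have h := G.sum_normEigenvalues_pow 0
  have h' : ∑ i, G.normEigenvalues i ^ 2 = (cycleGraph 2).homDensity G := by exact_mod_cast h
  simp only [Complex.norm_real, Real.norm_eq_abs, sq_abs]
  rw [h']
  exact homDensity_le_one _ _

theorem norm_normEigenvalues_le (i : V) : ‖(G.normEigenvalues i : ℂ)‖ ≤ 1 := by
  rw [← sq_le_one_iff₀ (norm_nonneg _)]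
  exact (Finset.single_le_sum (f := fun i => ‖(G.normEigenvalues i : ℂ)‖ ^ 2)
    (fun _ _ => sq_nonneg _) (Finset.mem_univ i)).trans G.sum_norm_normEigenvalues_sq_le

/-- The adjacency matrix has trace zero, so the determinant is already regularized. -/
theorem psi_eval_eq_prod (z : ℂ) :
    G.psi.eval z = ∏ i, primaryFactor (G.normEigenvalues i * z) := by
  have h0 : ∑ i, (G.normEigenvalues i : ℂ) = 0 := by
    have h := G.isHermitian_smul_adjMatrix.trace_pow_eq_sum 1
    simp only [pow_one, Matrix.trace_smul, trace_adjMatrix, smul_zero] at h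
    exact h.symm
  have h1 : G.psi.eval z = ∏ i, (1 - (G.normEigenvalues i : ℂ) * z) :=
    G.isHermitian_smul_adjMatrix.eval_charpolyRev_eq_prod z
  simp only [primaryFactor]
  rw [h1, Finset.prod_mul_distrib, ← Complex.exp_sum, ← Finset.sum_mul, h0]
  simp

theorem norm_psi_eval_le (z : ℂ) : ‖G.psi.eval z‖ ≤ Real.exp (‖z‖ ^ 2 / 2) := by
  rw [psi_eval_eq_prod, norm_prod]
  calc ∏ i, ‖primaryFactor (G.normEigenvalues i * z)‖
      ≤ ∏ i, Real.exp (‖(G.normEigenvalues i * z : ℂ)‖ ^ 2 / 2) :=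
        Finset.prod_le_prod (fun _ _ => norm_nonneg _) fun i _ => norm_primaryFactor_le _
    _ = Real.exp ((∑ i, ‖(G.normEigenvalues i : ℂ)‖ ^ 2) * (‖z‖ ^ 2 / 2)) := by
        rw [← Real.exp_sum, Finset.sum_mul]
        congr 1
        refine Finset.sum_congr rfl fun i _ => ?_
        rw [norm_mul]
        ring
    _ ≤ Real.exp (‖z‖ ^ 2 / 2) :=
        Real.exp_le_exp.2 (mul_le_of_le_one_left (by positivity)
          G.sum_norm_normEigenvalues_sq_le)

theorem psi_eval_eq_exp {z : ℂ} (hz : ‖z‖ < 1) :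
    G.psi.eval z = Complex.exp (-∑' k : ℕ,
      (((cycleGraph (k + 2)).homDensity G : ℝ) : ℂ) * (z ^ (k + 2) / ((k + 2 : ℕ) : ℂ))) := by
  have h := tprod_primaryFactor_eq_exp (a := fun i => (G.normEigenvalues i : ℂ))
    G.norm_normEigenvalues_le (Summable.of_finite) hz
  rw [tprod_fintype] at h
  rw [psi_eval_eq_prod, h]
  simp_rw [tsum_fintype, sum_normEigenvalues_pow]

theorem im_eq_zero_of_psi_eval_eq_zero {z : ℂ} (hz : G.psi.eval z = 0) : z.im = 0 := by
  rw [psi_eval_eq_prod, Finset.prod_eq_zero_iff] at hz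
  obtain ⟨i, -, hi⟩ := hz
  have h1 : (G.normEigenvalues i : ℂ) * z = 1 := by
    simpa [primaryFactor, sub_eq_zero, @eq_comm ℂ 1] using hi
  have h2 : z = ((G.normEigenvalues i)⁻¹ : ℝ) := by
    rw [Complex.ofReal_inv]
    exact eq_inv_of_mul_eq_one_right h1
  rw [h2, Complex.ofReal_im]

/-- `G.psi` with real coefficients. -/
def realPsi : ℝ[X] := (((Fintype.card V : ℝ)⁻¹) • G.adjMatrix ℝ).charpolyRev

theorem aeval_realPsi (z : ℂ) : aeval z G.realPsi = G.psi.eval z := by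
  have h : G.realPsi.map (algebraMap ℝ ℂ) = G.psi := by
    rw [realPsi, Matrix.map_charpolyRev, psi]
    congr 1
    ext i j
    by_cases hij : G.Adj i j <;> simp [adjMatrix_apply, hij]
  rw [← h, eval_map_algebraMap]

theorem realPsi_ne_zero : G.realPsi ≠ 0 := fun h => by
  have h1 : G.realPsi.eval 0 = 1 := Matrix.eval_charpolyRev
  rw [h, eval_zero] at h1
  exact zero_ne_one h1

end SimpleGraph

end Finite

/-! ### The characteristic function of a graphon -/

section RegDet

/-- The regularized determinant of genus one, as a product over an eigenbasis. -/
theorem hasProd_regDetFactor {E : Type*} [AddCommGroup E] [Module ℂ E] {T : Module.End ℂ E}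
    (hT : ∀ μ, T.maxGenEigenspace μ = T.eigenspace μ) {s : ℂ → Type*}
    (hs : ∀ μ ≠ 0, Finite (s μ) ∧ Nat.card (s μ) = Module.finrank ℂ (T.eigenspace μ)) {z p : ℂ}
    (h : HasProd (fun i : Σ μ, s μ => primaryFactor (i.1 * z)) p) :
    HasProd (regDetFactor 2 T z) p := by
  have h1 : regDetFactor 2 T z = fun μ =>
      primaryFactor (μ * z) ^ Module.finrank ℂ (T.eigenspace μ) := by
    funext μ
    rw [regDetFactor, hT, primaryFactor]
    simp
  rw [h1]
  refine h.sigma fun μ => ?_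
  rcases eq_or_ne μ 0 with rfl | hμ
  -- the eigenspace of `0` may be infinite-dimensional, but all its factors are `1`
  · simp [primaryFactor, hasProd_one]
  · obtain ⟨hfin, hcard⟩ := hs μ hμ
    have := Fintype.ofFinite (s μ)
    have h2 := hasProd_fintype fun _ : s μ => primaryFactor (μ * z)
    rwa [Finset.prod_const, Finset.card_univ, ← Nat.card_eq_fintype_card, hcard] at h2

end RegDet

namespace Graphon

variable (W : Graphon)

theorem norm_integral_iterKernel_le (m : ℕ) : ‖((∫ x, W.iterKernel m x x : ℝ) : ℂ)‖ ≤ 1 := by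
  have h1 : ∀ x, ‖W.iterKernel m x x‖ ≤ 1 := fun x => by
    have h := norm_integral_le_of_norm_le_const (μ := (volume : Measure (Fin m → I))) (C := 1)
      (f := fun u => pathProd W.toFun x u x) (Eventually.of_forall fun u => by
        rw [Real.norm_of_nonneg (W.pathProd_nonneg x u x)]
        exact W.pathProd_le_one x u x)
    simpa [iterKernel] using h
  have h := norm_integral_le_of_norm_le_const (μ := (volume : Measure I)) (C := 1)
    (f := fun x => W.iterKernel m x x) (Eventually.of_forall h1)
  rw [Complex.norm_real]
  simpa using h

/-- The eigenvalues of the kernel operator with multiplicity, as the family `a` over the index set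
of an eigenbasis (so that `0` may be repeated infinitely often), together with the properties that
the analysis of the product needs. -/
theorem exists_eigenvalues : ∃ (ι : Type) (a : ι → ℂ), (∀ i, ‖a i‖ ≤ 1) ∧
    (Summable fun i => ‖a i‖ ^ 2) ∧
    (∀ m : ℕ, ∑' i, a i ^ (m + 2) = ((∫ x, W.iterKernel (m + 1) x x : ℝ) : ℂ)) ∧
    (∀ z, HasProd (regDetFactor 2 (W.kernelOp : Module.End ℂ (Lp ℂ 2 (volume : Measure I))) z)
      (∏' i, primaryFactor (a i * z))) ∧
    ∀ μ ≠ 0, ∃ t : Finset ι, (∀ i, i ∈ t ↔ a i = μ) ∧ t.card = Module.finrank ℂ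
      (Module.End.eigenspace (W.kernelOp : Module.End ℂ (Lp ℂ 2 (volume : Measure I))) μ) := by
  obtain ⟨s, b, hb, hs⟩ :=
    exists_hilbertBasis_eigenvectors W.isCompactOperator_kernelOp W.isSymmetric_kernelOp
  have hnorm : ∀ i, ‖W.kernelOp (b i)‖ = ‖i.1‖ := fun i => by
    rw [hb, norm_smul, b.orthonormal.1 i, mul_one]
  have h1 : ∀ i : Σ μ, s μ, ‖i.1‖ ≤ 1 := fun i => by
    have h := W.sum_norm_kernelOp_sq_le b.orthonormal {i}
    rw [Finset.sum_singleton, hnorm] at h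
    exact (sq_le_one_iff₀ (norm_nonneg _)).1 h
  have h2 : Summable fun i : Σ μ, s μ => ‖i.1‖ ^ 2 := by
    have h := W.summable_norm_kernelOp_sq b.orthonormal
    simpa only [hnorm] using h
  refine ⟨Σ μ, s μ, fun i => i.1, h1, h2, fun m => ?_, fun z => ?_, fun μ hμ => ?_⟩
  · rw [(W.hasSum_eigenvalue_pow b hb m).tsum_eq]
    simp_rw [inner_row_kernelOp_pow_row]
    exact integral_complex_ofReal
  · refine hasProd_regDetFactor (fun μ => ?_) (s := fun μ => s μ)
      (fun μ hμ => ⟨(hs μ hμ).1, (hs μ hμ).2⟩) (multipliable_primaryFactor h1 h2 z).hasProd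
    exact W.isSymmetric_kernelOp.isFinitelySemisimple.maxGenEigenspace_eq_eigenspace μ
  · obtain ⟨hfin, hcard⟩ := hs μ hμ
    have := hfin.fintype
    refine ⟨Finset.univ.map (Function.Embedding.sigmaMk μ), fun i => ?_, ?_⟩
    · obtain ⟨ν, c⟩ := i
      simp only [Finset.mem_map, Finset.mem_univ, true_and, Function.Embedding.sigmaMk_apply]
      constructor
      · rintro ⟨c', h⟩
        exact (congrArg Sigma.fst h).symm
      · rintro rfl
        exact ⟨c, rfl⟩
    · rw [Finset.card_map, Finset.card_univ, ← hcard, Nat.card_eq_fintype_card]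

theorem multipliable_regDetFactor (z : ℂ) : Multipliable
    (regDetFactor 2 (W.kernelOp : Module.End ℂ (Lp ℂ 2 (volume : Measure I))) z) := by
  obtain ⟨ι, a, -, -, -, h, -⟩ := W.exists_eigenvalues
  exact (h z).multipliable

theorem differentiable_psi : Differentiable ℂ W.psi := by
  obtain ⟨ι, a, h1, h2, -, h, -⟩ := W.exists_eigenvalues
  have hreg : regDet 2 (W.kernelOp : Module.End ℂ (Lp ℂ 2 (volume : Measure I))) =
      fun z => ∏' i, primaryFactor (a i * z) := funext fun z => (h z).tprod_eq
  have hd : Differentiable ℂ fun z => regDet 2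
      (W.kernelOp : Module.End ℂ (Lp ℂ 2 (volume : Measure I))) z := by
    rw [hreg]
    exact differentiable_tprod_primaryFactor h1 h2
  refine hd.mul (Differentiable.cexp ?_)
  fun_prop

theorem norm_pow_div_le {z : ℂ} (hz : ‖z‖ < 1) (k : ℕ) :
    ‖z ^ (k + 2) / ((k + 2 : ℕ) : ℂ)‖ ≤ ‖z‖ ^ k := by
  rw [norm_div, norm_pow, Complex.norm_natCast]
  refine (div_le_self (by positivity) (Nat.one_le_cast.2 (by omega))).trans ?_
  exact pow_le_pow_of_le_one (norm_nonneg _) hz.le (by omega)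

/-- Near the origin, `ψ_W` is the exponential of the generating function of the densities of
cycles. The factor `exp (z² (‖W‖₂² - ‖W‖₁) / 2)` turns the second power sum `‖W‖₂²` of the
eigenvalues into the edge density `‖W‖₁`. -/
theorem psi_eq_exp {z : ℂ} (hz : ‖z‖ < 1) :
    W.psi z = Complex.exp (-∑' k : ℕ,
      ((W.homDensity (SimpleGraph.cycleGraph (k + 2)) : ℝ) : ℂ) *
        (z ^ (k + 2) / ((k + 2 : ℕ) : ℂ))) := by
  obtain ⟨ι, a, h1, h2, hp, h, -⟩ := W.exists_eigenvalues
  have hreg : regDet 2 (W.kernelOp : Module.End ℂ (Lp ℂ 2 (volume : Measure I))) z =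
      ∏' i, primaryFactor (a i * z) := (h z).tprod_eq
  have hsum : Summable fun k : ℕ => ((∫ x, W.iterKernel (k + 1) x x : ℝ) : ℂ) *
      (z ^ (k + 2) / ((k + 2 : ℕ) : ℂ)) := by
    refine Summable.of_norm_bounded (summable_geometric_of_lt_one (norm_nonneg z) hz) fun k => ?_
    rw [norm_mul]
    exact (mul_le_of_le_one_left (norm_nonneg _) (W.norm_integral_iterKernel_le _)).trans
      (norm_pow_div_le hz k)
  have hsingle := hasSum_ite_eq (0 : ℕ) (((W.norm1 - W.norm2 ^ 2 : ℝ) : ℂ) * (z ^ 2 / 2))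
  have hadd := (hsum.hasSum.add hsingle).congr_fun (g := fun k : ℕ =>
      ((W.homDensity (SimpleGraph.cycleGraph (k + 2)) : ℝ) : ℂ) *
        (z ^ (k + 2) / ((k + 2 : ℕ) : ℂ))) fun k => by
    rcases k with _ | k
    · rw [homDensity_cycleGraph_two, if_pos rfl, zero_add, ← norm2_sq]
      push_cast
      ring
    · rw [if_neg k.succ_ne_zero, add_zero, ← homDensity_cycleGraph]
  rw [hadd.tsum_eq, psi, hreg, tprod_primaryFactor_eq_exp h1 h2 hz]
  simp_rw [hp]
  rw [← Complex.exp_add]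
  congr 1
  push_cast
  ring

theorem psi_zero : W.psi 0 = 1 := by
  rw [W.psi_eq_exp (by simp)]
  simp

/-- At `μ⁻¹` exactly the factors of the eigenvalue `μ` vanish, each to first order. -/
theorem analyticOrderAt_psi {μ : ℂ} (hμ : μ ≠ 0) :
    analyticOrderAt W.psi μ⁻¹ = (Module.finrank ℂ (Module.End.eigenspace
      (W.kernelOp : Module.End ℂ (Lp ℂ 2 (volume : Measure I))) μ) : ℕ∞) := by
  obtain ⟨ι, a, h1, h2, -, h, hmult⟩ := W.exists_eigenvalues
  obtain ⟨t, ht, htcard⟩ := hmult μ hμ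
  obtain ⟨g, hg, hg0, hgz⟩ := exists_tprod_primaryFactor_eq_mul h1 h2 t
  rw [(W.differentiable_psi.analyticAt _).analyticOrderAt_eq_natCast]
  refine ⟨fun z => (-μ * Complex.exp (μ * z)) ^ t.card * (g z *
    Complex.exp (z ^ 2 * (((W.norm2 ^ 2 - W.norm1) / 2 : ℝ) : ℂ))), ?_, ?_, ?_⟩
  · refine Differentiable.analyticAt ?_ _
    fun_prop
  · refine mul_ne_zero (pow_ne_zero _ (mul_ne_zero (neg_ne_zero.2 hμ) (Complex.exp_ne_zero _)))
      (mul_ne_zero (hg0 _ fun i hi h0 => hi ((ht i).2 ?_)) (Complex.exp_ne_zero _))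
    rw [← div_eq_mul_inv, div_eq_one_iff_eq hμ] at h0
    exact h0
  · refine Eventually.of_forall fun z => ?_
    have hreg : regDet 2 (W.kernelOp : Module.End ℂ (Lp ℂ 2 (volume : Measure I))) z =
        ∏' i, primaryFactor (a i * z) := (h z).tprod_eq
    have hprod : ∏ i ∈ t, primaryFactor (a i * z) = primaryFactor (μ * z) ^ t.card := by
      rw [Finset.prod_congr rfl fun i hi => by rw [(ht i).1 hi], Finset.prod_const]
    have hfac : primaryFactor (μ * z) = (z - μ⁻¹) * (-μ * Complex.exp (μ * z)) := by
      rw [primaryFactor]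
      field_simp
      ring
    rw [psi, hreg, hgz, hprod, hfac, mul_pow, smul_eq_mul, htcard]
    ring

theorem psi_eq_zero_iff (z : ℂ) : W.psi z = 0 ↔ ∃ μ : ℂ, μ ≠ 0 ∧ Module.End.HasEigenvalue
    (W.kernelOp : Module.End ℂ (Lp ℂ 2 (volume : Measure I))) μ ∧ z = μ⁻¹ := by
  have key : ∀ μ : ℂ, μ ≠ 0 → (W.psi μ⁻¹ = 0 ↔ Module.End.HasEigenvalue
      (W.kernelOp : Module.End ℂ (Lp ℂ 2 (volume : Measure I))) μ) := fun μ hμ => by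
    have hfd := ContinuousLinearMap.finite_dimensional_eigenspace
      W.isCompactOperator_kernelOp μ hμ
    rw [← (W.differentiable_psi.analyticAt _).analyticOrderAt_ne_zero, W.analyticOrderAt_psi hμ,
      Nat.cast_ne_zero, Module.End.hasEigenvalue_iff, Ne, Submodule.finrank_eq_zero]
  constructor
  · intro hz
    have hz0 : z ≠ 0 := by
      rintro rfl
      rw [psi_zero] at hz
      exact one_ne_zero hz
    exact ⟨z⁻¹, inv_ne_zero hz0, (key _ (inv_ne_zero hz0)).1 (by rwa [inv_inv]),
      (inv_inv z).symm⟩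
  · rintro ⟨μ, hμ, he, rfl⟩
    exact (key μ hμ).2 he

end Graphon

/-! ### Left-convergent sequences -/

section Limit

theorem iteratedDeriv_eval (p : ℂ[X]) (k : ℕ) (z : ℂ) :
    iteratedDeriv k (fun x => p.eval x) z = (derivative^[k] p).eval z := by
  induction k generalizing z with
  | zero => simp
  | succ k ih =>
    rw [iteratedDeriv_succ, funext ih, Polynomial.deriv, Function.iterate_succ_apply']

variable {V : ℕ → Type*} [∀ n, Fintype (V n)] [∀ n, DecidableEq (V n)]
  (G : ∀ n, SimpleGraph (V n)) [∀ n, DecidableRel (G n).Adj] {W : Graphon}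

theorem LeftConverges.tendsto_psi_eval (hG : LeftConverges G W) {z : ℂ} (hz : ‖z‖ < 1) :
    Tendsto (fun n => (G n).psi.eval z) atTop (𝓝 (W.psi z)) := by
  rw [W.psi_eq_exp hz]
  simp_rw [fun n => (G n).psi_eval_eq_exp hz]
  refine (Complex.continuous_exp.tendsto _).comp (Tendsto.neg ?_)
  refine tendsto_tsum_of_dominated_convergence (bound := fun k : ℕ => ‖z‖ ^ k)
    (summable_geometric_of_lt_one (norm_nonneg z) hz) (fun k => ?_)
    (Eventually.of_forall fun n k => ?_)
  · exact ((Complex.continuous_ofReal.tendsto _).comp (hG _ _)).mul_const _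
  · rw [norm_mul, Complex.norm_real, Real.norm_of_nonneg (SimpleGraph.homDensity_nonneg _ _)]
    exact (mul_le_of_le_one_left (norm_nonneg _) (SimpleGraph.homDensity_le_one _ _)).trans
      (Graphon.norm_pow_div_le hz k)

theorem LeftConverges.norm_psi_eval_le (R : ℝ) :
    ∃ M : ℝ, ∀ n z, ‖z‖ ≤ R → ‖(G n).psi.eval z‖ ≤ M :=
  ⟨Real.exp (R ^ 2 / 2), fun n z hz => ((G n).norm_psi_eval_le z).trans (by gcongr)⟩

theorem LeftConverges.tendstoUniformlyOn_psi (hG : LeftConverges G W) {K : Set ℂ}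
    (hK : IsCompact K) : TendstoUniformlyOn (fun n z => (G n).psi.eval z) W.psi atTop K :=
  tendstoUniformlyOn_of_tendsto_sphere (r := 1 / 2) (by norm_num)
    (fun n => (G n).psi.differentiable) W.differentiable_psi
    (LeftConverges.norm_psi_eval_le G)
    (fun z hz => hG.tendsto_psi_eval G (by rw [hz]; norm_num)) hK

theorem LeftConverges.tendsto_psi_coeff (hG : LeftConverges G W) (k : ℕ) :
    Tendsto (fun n => (G n).psi.coeff k) atTop
      (𝓝 (iteratedDeriv k W.psi 0 / (k.factorial : ℂ))) := by
  obtain ⟨M, hM⟩ := LeftConverges.norm_psi_eval_le G (1 / 2)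
  have h := tendsto_iteratedDeriv_of_tendsto_sphere (R := 1 / 2) (by norm_num)
    (fun n => (G n).psi.differentiable) W.differentiable_psi hM
    (fun z hz => hG.tendsto_psi_eval G (by rw [hz]; norm_num)) k
  have hk : (k.factorial : ℂ) ≠ 0 := by exact_mod_cast k.factorial_ne_zero
  refine (h.div_const (k.factorial : ℂ)).congr fun n => ?_
  rw [iteratedDeriv_eval, ← coeff_zero_eq_eval_zero, coeff_iterate_derivative, zero_add,
    Nat.descFactorial_self, nsmul_eq_mul, mul_div_cancel_left₀ _ hk]

theorem LeftConverges.isLaguerrePolya_psi (hG : LeftConverges G W) : IsLaguerrePolya W.psi := by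
  refine ⟨fun h => ?_, fun n => (G n).realPsi, fun n => ⟨(G n).realPsi_ne_zero, fun z hz => ?_⟩, ?_⟩
  · have h0 := W.psi_zero
    rw [h] at h0
    exact zero_ne_one h0
  · rw [SimpleGraph.aeval_realPsi] at hz
    exact (G n).im_eq_zero_of_psi_eval_eq_zero hz
  · simp_rw [SimpleGraph.aeval_realPsi]
    rw [tendstoLocallyUniformly_iff_forall_isCompact]
    exact fun K hK => hG.tendstoUniformlyOn_psi G hK

end Limit

end

theorem theorem2 {V : ℕ → Type*} [∀ n, Fintype (V n)] [∀ n, DecidableEq (V n)]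
    (G : ∀ n, SimpleGraph (V n)) [∀ n, DecidableRel (G n).Adj]
    (hV : Tendsto (fun n => Fintype.card (V n)) atTop atTop)
    (W : Graphon) (hG : LeftConverges G W) :
    -- the product that defines `det^{(2)}(I - zW)` converges (unconditionally)
    (∀ z : ℂ, Multipliable
      (regDetFactor 2 (W.kernelOp : Module.End ℂ (Lp ℂ 2 (volume : Measure I))) z)) ∧
    -- pointwise convergence
    (∀ z : ℂ, Tendsto (fun n => (G n).psi.eval z) atTop (𝓝 (W.psi z))) ∧
    -- uniform convergence on compact sets
    (∀ K : Set ℂ, IsCompact K →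
      TendstoUniformlyOn (fun n z => (G n).psi.eval z) W.psi atTop K) ∧
    -- convergence of each coefficient, to the Taylor coefficient of the limit
    (∀ k : ℕ, Tendsto (fun n => (G n).psi.coeff k) atTop
      (𝓝 (iteratedDeriv k W.psi 0 / (k.factorial : ℂ)))) ∧
    -- the limit is entire of Laguerre–Pólya class
    Differentiable ℂ W.psi ∧
    IsLaguerrePolya W.psi ∧
    -- its roots are the reciprocals of the nonzero eigenvalues, with multiplicity
    {z : ℂ | W.psi z = 0} = {z : ℂ | ∃ μ : ℂ, μ ≠ 0 ∧ Module.End.HasEigenvalue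
      (W.kernelOp : Module.End ℂ (Lp ℂ 2 (volume : Measure I))) μ ∧ z = μ⁻¹} ∧
    (∀ μ : ℂ, μ ≠ 0 →
      FiniteDimensional ℂ (Module.End.eigenspace
        (W.kernelOp : Module.End ℂ (Lp ℂ 2 (volume : Measure I))) μ) ∧
      analyticOrderAt W.psi μ⁻¹ = (Module.finrank ℂ (Module.End.eigenspace
        (W.kernelOp : Module.End ℂ (Lp ℂ 2 (volume : Measure I))) μ) : ℕ∞)) := by
  refine ⟨W.multipliable_regDetFactor, fun z => ?_, fun K hK => hG.tendstoUniformlyOn_psi G hK,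
    hG.tendsto_psi_coeff G, W.differentiable_psi, hG.isLaguerrePolya_psi G,
    Set.ext W.psi_eq_zero_iff, fun μ hμ => ⟨?_, W.analyticOrderAt_psi hμ⟩⟩
  · exact (hG.tendstoUniformlyOn_psi G isCompact_singleton).tendsto_at (Set.mem_singleton z)
  · exact ContinuousLinearMap.finite_dimensional_eigenspace W.isCompactOperator_kernelOp μ hμ
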